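/- Let $n\in\{1,2,3\}$, $\lambda>0$ (the mass ratio light/heavy), and work in the momentum representation: the one-particle space is $L^2(\mathbb R^n)$, the two-particle space is $L^2(\mathbb R^n)\otimes L^2(\mathbb R^n)=L^2(\mathbb R^n\times\mathbb R^n)$ with heavy momentum $\vec K$ (first factor) and light momentum $\vec k$ (second factor). Put $\vec k_d=\frac{1}{1+\lambda}\vec k-\frac{\lambda}{1+\lambda}\vec K$ and $\vec K_{cm}=\vec k+\vec K$. Let $\mathbf S_\lambda=I+\mathbf A_\lambda$ be the scattering operator of the point interaction, i.e. $$\mathbf A_\lambda=I_{cm}\otimes\big(S_\lambda(|\vec k_d|)\otimes|\phi\rangle\langle\phi|\big),$$ where the displacement momentum $\vec k_d$ is written in polar coordinates, $\phi$ is the normalized constant function on the unit sphere (so $|\phi\rangle\langle\phi|$ is averaging over the sphere), and $$S_\lambda(k)=\frac{-i\alpha}{k+\frac i2\alpha}\ (n=1),\qquad S_\lambda(k)=\frac{-i\pi}{l^{-1}+\gamma+\ln\frac k2+i\frac\pi2}\ (n=2),\qquad S_\lambda(k)=\frac{-2ik}{l^{-1}+ik}\ (n=3),$$ with $\alpha=\frac{\lambda}{1+\lambda}\alpha_0$,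 $l=\frac{\lambda}{1+\lambda}l_0$, fixed real $\alpha_0,l_0\neq0$, and $\gamma$ the Euler–Mascheroni constant. Let $\rho$ be a trace class operator on $L^2(\mathbb R^n)$ (for instance a density matrix) which in the momentum representation has a continuous integral kernel $\rho(\vec k_1,\vec k_2)$. Let $(\tau_{\vec a}f)(\vec p)=f(\vec p-\vec a)$, let $p_{\vec k,\sigma,\lambda}$ be multiplication by $\rho\big((1+\lambda)\vec k+\lambda\vec P,(\sigma+\lambda)\vec k+\lambda\vec P\big)$ as a function of the momentum $\vec P$, and let $d\sigma$ be the Haar measure of $SO_n$ with total mass $1$ (for $n=1$: the uniform probability measure on $\{+1,-1\}$). Then $$\mathrm{Tr}_2\big[(I\otimes\rho)\mathbf A_\lambda^*\big]=(1+\lambda)^n\int_{\mathbb R^n}d\vec k\int_{SO_n}d\sigma\;\tau_{\vec k}\,\tau_{\sigma\vec k}^*\,p_{\vec k,\sigma,\lambda}\,\overline{S_\lambda(|\vec k|)} .$$ Here the left side is the bounded operator $B'$ with $\langle w,B'v\rangle=\sum_i\langle w\otimes e_i,(I\otimes\rho)\mathbf A_\lambda^*(v\otimes e_i)\rangle$ for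 every orthonormal basis $(e_i)$, the series being convergent. The integral converges strongly in the following sense: for each measurable set $E$ of parameters $(\vec k,\sigma)$ the integral over $E$ defines a bounded operator (for each $\psi\in L^2(\mathbb R^n)$, the integral over $E$ of the integrand applied to $\psi$ converges absolutely at almost every momentum $\vec P$), and along every increasing sequence of measurable sets with union the whole parameter space these operators converge strongly to the full integral. -/

import Mathlib

open MeasureTheory Filter Topology

noncomputable section

namespace PointScattering

/-- Momentum space `ℝⁿ`. -/
abbrev Mom (n : ℕ) := EuclideanSpace ℝ (Fin n)

/-- One-particle Hilbert space `L²(ℝⁿ)` in the momentum representation. -/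
abbrev L2 (n : ℕ) := Lp ℂ 2 (volume : Measure (Mom n))

/-- Two-particle Hilbert space `L²(ℝⁿ) ⊗ L²(ℝⁿ) = L²(ℝⁿ × ℝⁿ)` in the momentum representation.
The first factor is the heavy particle (momentum `K`), the second the light one (momentum `k`). -/
abbrev L2Pair (n : ℕ) := Lp ℂ 2 (volume : Measure (Mom n × Mom n))

variable {n : ℕ}

/-! ### Product vectors, trace class operators, `I ⊗ ρ` and the partial trace -/

lemma memLp_tensor (w u : L2 n) :
    MemLp (fun p : Mom n × Mom n => w p.1 * u p.2) 2 volume := by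
  have hw := Lp.memLp w
  have hu := Lp.memLp u
  have hm : AEStronglyMeasurable (fun p : Mom n × Mom n => w p.1 * u p.2) volume :=
    (hw.1.comp_fst).mul (hu.1.comp_snd)
  rw [memLp_two_iff_integrable_sq_norm hm]
  have := ((memLp_two_iff_integrable_sq_norm hw.1).1 hw).mul_prod
    ((memLp_two_iff_integrable_sq_norm hu.1).1 hu)
  refine this.congr (Filter.Eventually.of_forall fun p => ?_)
  simp [mul_pow]

/-- The product wave function `w ⊗ u`, `(K, k) ↦ w K * u k`. -/
def tensor (w u : L2 n) : L2Pair n := (memLp_tensor w u).toLp _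

lemma coeFn_tensor (w u : L2 n) :
    tensor w u =ᵐ[volume] fun p => w p.1 * u p.2 := MemLp.coeFn_toLp _

lemma inner_tensor (w u w' u' : L2 n) :
    inner ℂ (tensor w u) (tensor w' u') = inner ℂ w w' * inner ℂ u u' := by
  rw [L2.inner_def, L2.inner_def, L2.inner_def,
    ← integral_prod_mul (fun x => inner ℂ (w x) (w' x)) (fun x => inner ℂ (u x) (u' x))]
  refine integral_congr_ae ?_
  filter_upwards [coeFn_tensor w u, coeFn_tensor w' u'] with p h h'
  rw [h, h']
  simp only [RCLike.inner_apply, map_mul]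
  ring

lemma norm_tensor (w u : L2 n) : ‖tensor w u‖ = ‖w‖ * ‖u‖ := by
  have h := congrArg Complex.re (inner_tensor w u w u)
  rw [inner_self_eq_norm_sq_to_K, inner_self_eq_norm_sq_to_K, inner_self_eq_norm_sq_to_K] at h
  norm_cast at h
  rw [← mul_pow] at h
  exact (pow_left_inj₀ (norm_nonneg _) (by positivity) two_ne_zero).1 h

lemma ae_fst {P : Mom n → Prop} (h : ∀ᵐ x, P x) : ∀ᵐ p : Mom n × Mom n, P p.1 :=
  Measure.quasiMeasurePreserving_fst.ae h

lemma ae_snd {P : Mom n → Prop} (h : ∀ᵐ x, P x) : ∀ᵐ p : Mom n × Mom n, P p.2 :=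
  Measure.quasiMeasurePreserving_snd.ae h

/-- The bounded operator `id ⊗ |u⟩ : w ↦ w ⊗ u`. -/
def tensorRight (u : L2 n) : L2 n →L[ℂ] L2Pair n :=
  LinearMap.mkContinuous
    { toFun := fun w => tensor w u
      map_add' := fun w w' => by
        apply Lp.ext
        filter_upwards [coeFn_tensor (w + w') u, coeFn_tensor w u, coeFn_tensor w' u,
          Lp.coeFn_add (tensor w u) (tensor w' u), ae_fst (Lp.coeFn_add w w')]
          with p h1 h2 h3 h4 h5
        rw [h1, h4, Pi.add_apply, h2, h3, h5, Pi.add_apply, add_mul]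
      map_smul' := fun c w => by
        apply Lp.ext
        filter_upwards [coeFn_tensor (c • w) u, coeFn_tensor w u,
          Lp.coeFn_smul c (tensor w u), ae_fst (Lp.coeFn_smul c w)]
          with p h1 h2 h4 h5
        rw [RingHom.id_apply, h1, h4, Pi.smul_apply, h2, h5, Pi.smul_apply, smul_eq_mul,
          smul_eq_mul, mul_assoc] }
    ‖u‖ fun w => (norm_tensor w u).le.trans (mul_comm _ _).le


/-- Trace class: `ρ = ∑ⱼ |fⱼ⟩⟨gⱼ|` with `∑ⱼ ‖fⱼ‖ ‖gⱼ‖ < ∞`. -/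
def IsTraceClass (ρ : L2 n →L[ℂ] L2 n) : Prop :=
  ∃ f g : ℕ → L2 n, Summable (fun j => ‖f j‖ * ‖g j‖) ∧
    ∀ ψ, HasSum (fun j => inner ℂ (g j) ψ • f j) (ρ ψ)

/-- The operator `I ⊗ ρ = ∑ⱼ (id ⊗ |fⱼ⟩)(id ⊗ ⟨gⱼ|)` on the two-particle space, for `ρ = ∑ⱼ |fⱼ⟩⟨gⱼ|`.
By `idTensor_tensor` below it is the bounded operator with `w ⊗ u ↦ w ⊗ ρ u`, so it does not depend
on the chosen expansion. -/
def idTensor {ρ : L2 n →L[ℂ] L2 n} (hρ : IsTraceClass ρ) : L2Pair n →L[ℂ] L2Pair n :=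
  ∑' j, tensorRight (hρ.choose j) ∘L
    ContinuousLinearMap.adjoint (tensorRight (hρ.choose_spec.choose j))

lemma tensorRight_apply (u w : L2 n) : tensorRight u w = tensor w u := rfl

lemma norm_tensorRight_le (u : L2 n) : ‖tensorRight u‖ ≤ ‖u‖ :=
  LinearMap.mkContinuous_norm_le _ (norm_nonneg _) _

lemma adjoint_tensorRight_tensor (g w u : L2 n) :
    ContinuousLinearMap.adjoint (tensorRight g) (tensor w u) = inner ℂ g u • w := by
  refine ext_inner_left ℂ fun x => ?_
  rw [ContinuousLinearMap.adjoint_inner_right, tensorRight_apply, inner_tensor, inner_smul_right,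
    mul_comm]

lemma tensor_smul (c : ℂ) (w u : L2 n) : tensor (c • w) u = c • tensor w u :=
  (tensorRight u).map_smul c w

lemma tensor_smul_right (c : ℂ) (w u : L2 n) : tensor w (c • u) = c • tensor w u := by
  apply Lp.ext
  filter_upwards [coeFn_tensor w (c • u), coeFn_tensor w u,
    Lp.coeFn_smul c (tensor w u), ae_snd (Lp.coeFn_smul c u)] with p h1 h2 h4 h5
  rw [h1, h4, Pi.smul_apply, h2, h5, Pi.smul_apply, smul_eq_mul, smul_eq_mul, mul_left_comm]

/-- The bounded operator `|w⟩ ⊗ id : u ↦ w ⊗ u`. -/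
def tensorLeft (w : L2 n) : L2 n →L[ℂ] L2Pair n :=
  LinearMap.mkContinuous
    { toFun := fun u => tensor w u
      map_add' := fun u u' => by
        apply Lp.ext
        filter_upwards [coeFn_tensor w (u + u'), coeFn_tensor w u, coeFn_tensor w u',
          Lp.coeFn_add (tensor w u) (tensor w u'), ae_snd (Lp.coeFn_add u u')]
          with p h1 h2 h3 h4 h5
        rw [h1, h4, Pi.add_apply, h2, h3, h5, Pi.add_apply, mul_add]
      map_smul' := fun c u => tensor_smul_right c w u }
    ‖w‖ fun u => (norm_tensor w u).le

theorem idTensor_tensor {ρ : L2 n →L[ℂ] L2 n} (hρ : IsTraceClass ρ) (w u : L2 n) :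
    idTensor hρ (tensor w u) = tensor w (ρ u) := by
  have hs := hρ.choose_spec.choose_spec.1
  have hρ' := hρ.choose_spec.choose_spec.2 u
  have hsum : Summable fun j => tensorRight (hρ.choose j) ∘L
      ContinuousLinearMap.adjoint (tensorRight (hρ.choose_spec.choose j)) := by
    refine Summable.of_norm_bounded hs fun j => ?_
    refine (ContinuousLinearMap.opNorm_comp_le _ _).trans ?_
    rw [LinearIsometryEquiv.norm_map]
    exact mul_le_mul (norm_tensorRight_le _) (norm_tensorRight_le _) (norm_nonneg _)
      (norm_nonneg _)
  have h1 := (hsum.hasSum.mapL (ContinuousLinearMap.apply ℂ (L2Pair n) (tensor w u)))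
  have h2 := hρ'.mapL (tensorLeft w)
  refine h1.unique ?_
  change HasSum _ (tensorLeft w (ρ u))
  convert h2 using 2 with j
  simp only [ContinuousLinearMap.apply_apply, ContinuousLinearMap.comp_apply,
    adjoint_tensorRight_tensor, tensorRight_apply, tensor_smul]
  exact (tensor_smul_right _ _ _).symm

/-- `B = Tr₂[Y]`, the partial trace over the second (light) factor: for every orthonormal basis `(eᵢ)`
of the light-particle space, `⟨w, B v⟩ = ∑ᵢ ⟨w ⊗ eᵢ, Y (v ⊗ eᵢ)⟩`, the series being convergent. -/
def IsPartialTrace (Y : L2Pair n →L[ℂ] L2Pair n) (B : L2 n →L[ℂ] L2 n) : Prop :=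
  ∀ (ι : Type) (e : HilbertBasis ι ℂ (L2 n)) (w v : L2 n),
    HasSum (fun i => inner ℂ (tensor w (e i)) (Y (tensor v (e i)))) (inner ℂ w (B v))

/-! ### The scattering operator of the point interaction -/

/-- The scattering coefficient `S_λ(k)`, `k ≥ 0`, in dimensions one, two, three. Here `a` is the
resonance parameter `α₀` (dimension one) or the scattering length `l₀` (dimensions two and three) at
fixed interaction strength, and `c = λ a / (1 + λ)` is the corresponding `α` or `l`. -/
def scatteringCoeff (n : ℕ) (a lam k : ℝ) : ℂ :=
  let c : ℝ := lam / (1 + lam) * a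
  if n = 1 then -(Complex.I * c) / (k + Complex.I * (c / 2))
  else if n = 2 then -(Complex.I * Real.pi) /
    ((c⁻¹ + Real.eulerMascheroniConstant + Real.log (k / 2) : ℝ) + Complex.I * (Real.pi / 2))
  else -(2 * Complex.I * k) / ((c⁻¹ : ℝ) + Complex.I * k)

lemma norm_scatteringCoeff_le (n : ℕ) (a lam k : ℝ) : ‖scatteringCoeff n a lam k‖ ≤ 2 := by
  have key : ∀ z w : ℂ, ‖z‖ ≤ 2 * |w.im| → ‖z / w‖ ≤ 2 := fun z w h => by
    rw [norm_div]
    exact div_le_of_le_mul₀ (norm_nonneg _) zero_le_two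
      (h.trans (by gcongr; exact Complex.abs_im_le_norm w))
  unfold scatteringCoeff
  generalize lam / (1 + lam) * a = c
  split_ifs <;> refine key _ _ (le_of_eq ?_)
  · simp [abs_div]; ring
  · simp [abs_div]; ring
  · simp 

lemma measurable_scatteringCoeff (n : ℕ) (a lam : ℝ) :
    Measurable fun k => scatteringCoeff n a lam k := by
  unfold scatteringCoeff
  split_ifs <;> fun_prop

/-- The unit sphere of `ℝⁿ`. -/
abbrev USphere (n : ℕ) := Metric.sphere (0 : Mom n) 1

/-- The surface measure of the unit sphere, divided by the total surface area `sₙ`. -/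
def sphereMeasure (n : ℕ) : Measure (USphere n) :=
  ((volume : Measure (Mom n)).toSphere Set.univ)⁻¹ • (volume : Measure (Mom n)).toSphere

instance [NeZero n] : IsProbabilityMeasure (sphereMeasure n) := by
  have : Nonempty (Fin n) := ⟨0⟩
  refine ⟨?_⟩
  rw [sphereMeasure, Measure.smul_apply, smul_eq_mul]
  exact ENNReal.inv_mul_cancel
    (by rw [Ne, Measure.measure_univ_eq_zero]; exact Measure.toSphere_ne_zero _)
    (measure_ne_top _ _)

lemma toSphere_eq_smul [NeZero n] : (volume : Measure (Mom n)).toSphere =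
    (volume : Measure (Mom n)).toSphere Set.univ • sphereMeasure n := by
  have : Nonempty (Fin n) := ⟨0⟩
  rw [sphereMeasure, smul_smul, ENNReal.mul_inv_cancel, one_smul]
  · rw [Ne, Measure.measure_univ_eq_zero]; exact Measure.toSphere_ne_zero _
  · exact measure_ne_top _ _

lemma lintegral_polar [NeZero n] {f : Mom n → ENNReal} (hf : Measurable f) :
    ∫⁻ x, f x = ∫⁻ r, ∫⁻ ω, f (r.1 • ω.1) ∂(volume : Measure (Mom n)).toSphere
      ∂(Measure.volumeIoiPow (n - 1)) := by
  have : Nonempty (Fin n) := ⟨0⟩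
  have h0 : (volume : Measure (Mom n)).restrict {0}ᶜ = volume := by
    rw [Measure.restrict_eq_self_of_ae_mem]
    exact compl_mem_ae_iff.2 (measure_singleton _)
  have hmp := (volume : Measure (Mom n)).measurePreserving_homeomorphUnitSphereProd
  rw [finrank_euclideanSpace_fin] at hmp
  have hmp' := hmp.symm (homeomorphUnitSphereProd (Mom n)).toMeasurableEquiv
  calc ∫⁻ x, f x = ∫⁻ x in {0}ᶜ, f x := by rw [h0]
    _ = ∫⁻ x : ({0}ᶜ : Set (Mom n)), f x ∂(Measure.comap Subtype.val volume) :=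
        (lintegral_subtype_comap (measurableSet_singleton _).compl f).symm
    _ = ∫⁻ q, f ((homeomorphUnitSphereProd (Mom n)).symm q).1
          ∂((volume : Measure (Mom n)).toSphere.prod (Measure.volumeIoiPow (n - 1))) :=
        (hmp'.lintegral_comp (hf.comp measurable_subtype_coe)).symm
    _ = ∫⁻ q, f (q.2.1 • q.1.1)
          ∂((volume : Measure (Mom n)).toSphere.prod (Measure.volumeIoiPow (n - 1))) := by
        simp
    _ = _ := by
        rw [lintegral_prod_symm _ (by fun_prop)]

/-- Averaging over spheres preserves Lebesgue integrals. -/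
lemma lintegral_sphere_mean [NeZero n] {f : Mom n → ENNReal} (hf : Measurable f) :
    ∫⁻ x : Mom n, ∫⁻ ω, f (‖x‖ • ω.1) ∂(sphereMeasure n) = ∫⁻ x, f x := by
  have hm : Measurable fun x : Mom n => ∫⁻ ω, f (‖x‖ • ω.1) ∂(sphereMeasure n) := by
    apply Measurable.lintegral_prod_right'
      (f := fun p : Mom n × USphere n => f (‖p.1‖ • p.2.1))
    fun_prop
  rw [lintegral_polar hm, lintegral_polar hf]
  refine lintegral_congr fun r => ?_
  have : ∀ ω : USphere n, ‖(r.1 : ℝ) • (ω.1 : Mom n)‖ = (r.1 : ℝ) := fun ω => by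
    rw [norm_smul, Real.norm_of_nonneg (le_of_lt r.2), mem_sphere_zero_iff_norm.1 ω.2, mul_one]
  simp only [this]
  rw [lintegral_const]
  conv_rhs => rw [toSphere_eq_smul, lintegral_smul_measure]
  rw [smul_eq_mul, mul_comm]

/-- `((d, c), ω) ↦ (‖d‖ ω, c)` -/
def polarMap (n : ℕ) (q : (Mom n × Mom n) × USphere n) : Mom n × Mom n :=
  (‖q.1.1‖ • q.2.1, q.1.2)

lemma measurePreserving_polarMap [NeZero n] :
    MeasurePreserving (polarMap n) ((volume : Measure (Mom n × Mom n)).prod (sphereMeasure n))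
      volume := by
  have hm : Measurable (polarMap n) := by unfold polarMap; fun_prop
  refine ⟨hm, Measure.ext_of_lintegral _ fun f hf => ?_⟩
  rw [lintegral_map hf hm, lintegral_prod (fun q => f (polarMap n q)) (hf.comp hm).aemeasurable, Measure.volume_eq_prod,
    lintegral_prod_symm (fun p => ∫⁻ ω, f (polarMap n (p, ω)) ∂(sphereMeasure n))
      (Measurable.lintegral_prod_right' (f := fun q => f (polarMap n q)) (hf.comp hm)).aemeasurable,
    lintegral_prod_symm _ hf.aemeasurable]
  refine lintegral_congr fun c => ?_
  exact lintegral_sphere_mean (f := fun x => f (x, c)) (by fun_prop)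

/-- The mean of `f(·, c)` over the sphere of radius `‖d‖`, at `p = (d, c)`. -/
def sphereMean (f : Mom n × Mom n → ℂ) (p : Mom n × Mom n) : ℂ :=
  ∫ ω, f (‖p.1‖ • ω.1, p.2) ∂(sphereMeasure n)

lemma ae_integrable_polar [NeZero n] (f : L2Pair n) :
    ∀ᵐ p : Mom n × Mom n, MemLp (fun ω => f (polarMap n (p, ω))) 2 (sphereMeasure n) := by
  have hF := (Lp.memLp f).comp_measurePreserving measurePreserving_polarMap
  have h1 := hF.1.prodMk_left
  have h2 := (memLp_two_iff_integrable_sq_norm hF.1).1 hF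
  filter_upwards [h1, h2.prod_right_ae] with p hp hp'
  exact (memLp_two_iff_integrable_sq_norm hp).2 hp'

lemma sphereMean_bound [NeZero n] (f : L2Pair n) :
    MemLp (sphereMean f) 2 volume ∧ eLpNorm (sphereMean f) 2 volume ≤ eLpNorm f 2 volume := by
  have hF := (Lp.memLp f).comp_measurePreserving measurePreserving_polarMap
  have hm : AEStronglyMeasurable (sphereMean f) volume := hF.1.integral_prod_right'
  have key : eLpNorm (sphereMean f) 2 volume ≤ eLpNorm f 2 volume := by
    rw [← eLpNorm_comp_measurePreserving (Lp.memLp f).1 measurePreserving_polarMap]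
    rw [eLpNorm_eq_lintegral_rpow_enorm_toReal two_ne_zero ENNReal.ofNat_ne_top,
      eLpNorm_eq_lintegral_rpow_enorm_toReal two_ne_zero ENNReal.ofNat_ne_top]
    refine ENNReal.rpow_le_rpow ?_ (by positivity)
    rw [lintegral_prod _ (hF.1.enorm.pow_const _)]
    refine lintegral_mono_ae ?_
    filter_upwards [ae_integrable_polar f] with p hp
    have h1 : ‖sphereMean f p‖ₑ ≤ eLpNorm (fun ω => f (polarMap n (p, ω))) 2 (sphereMeasure n) :=
      (enorm_integral_le_lintegral_enorm _).trans
        ((eLpNorm_one_eq_lintegral_enorm).symm.le.trans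
          (eLpNorm_le_eLpNorm_of_exponent_le one_le_two hp.1))
    refine (ENNReal.rpow_le_rpow h1 (by positivity)).trans ?_
    rw [eLpNorm_eq_lintegral_rpow_enorm_toReal two_ne_zero ENNReal.ofNat_ne_top,
      ← ENNReal.rpow_mul]
    simp
  exact ⟨⟨hm, key.trans_lt (Lp.memLp f).2⟩, key⟩

lemma sphereMean_congr [NeZero n] {f g : Mom n × Mom n → ℂ} (h : f =ᵐ[volume] g) :
    sphereMean f =ᵐ[volume] sphereMean g := by
  have := (measurePreserving_polarMap (n := n)).quasiMeasurePreserving.ae h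
  filter_upwards [Measure.ae_ae_of_ae_prod this] with p hp
  exact integral_congr_ae hp

lemma memLp_radial [NeZero n] {m : ℝ → ℂ} (hm : Measurable m) {C : ℝ} (hC : ∀ k, ‖m k‖ ≤ C)
    (f : L2Pair n) : MemLp (fun p => m ‖p.1‖ * sphereMean f p) 2 volume :=
  (sphereMean_bound f).1.of_le_mul (c := C)
    ((hm.comp (by fun_prop)).aestronglyMeasurable.mul (sphereMean_bound f).1.1)
    (Filter.Eventually.of_forall fun p => by
      rw [norm_mul]; exact mul_le_mul_of_nonneg_right (hC _) (norm_nonneg _))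

/-- The operator `I_cm ⊗ (m(|·|) ⊗ |φ⟩⟨φ|)` on functions of (displacement momentum, center-of-mass
momentum): `φ` is the normalized constant function on the unit sphere, so that `|φ⟩⟨φ|` is the mean
over the angles, and `m` multiplies in the radial variable. `C` is any bound for `m`. -/
def radialOp [NeZero n] (m : ℝ → ℂ) (hm : Measurable m) (C : ℝ) (hC : ∀ k, ‖m k‖ ≤ C) :
    L2Pair n →L[ℂ] L2Pair n :=
  LinearMap.mkContinuous
    { toFun := fun f => (memLp_radial hm hC f).toLp _
      map_add' := fun f g => by
        apply Lp.ext
        filter_upwards [(memLp_radial hm hC (f + g)).coeFn_toLp, (memLp_radial hm hC f).coeFn_toLp,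
          (memLp_radial hm hC g).coeFn_toLp, Lp.coeFn_add ((memLp_radial hm hC f).toLp _)
          ((memLp_radial hm hC g).toLp _), sphereMean_congr (Lp.coeFn_add f g),
          ae_integrable_polar f, ae_integrable_polar g] with p h1 h2 h3 h4 h5 h6 h7
        rw [h1, h4, Pi.add_apply, h2, h3, h5, ← mul_add]
        congr 1
        exact integral_add (h6.integrable one_le_two) (h7.integrable one_le_two)
      map_smul' := fun c f => by
        apply Lp.ext
        filter_upwards [(memLp_radial hm hC (c • f)).coeFn_toLp, (memLp_radial hm hC f).coeFn_toLp,
          Lp.coeFn_smul c ((memLp_radial hm hC f).toLp _), sphereMean_congr (Lp.coeFn_smul c f)]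
          with p h1 h2 h3 h4
        rw [RingHom.id_apply, h1, h3, Pi.smul_apply, h2, h4, smul_eq_mul, mul_left_comm]
        congr 1
        exact integral_const_mul c _ }
    C fun f => by
      have hC0 : 0 ≤ C := (norm_nonneg _).trans (hC 0)
      change ‖(memLp_radial hm hC f).toLp _‖ ≤ _
      rw [Lp.norm_toLp, Lp.norm_def, ← ENNReal.toReal_ofReal hC0, ← ENNReal.toReal_mul]
      refine ENNReal.toReal_mono (ENNReal.mul_ne_top ENNReal.ofReal_ne_top (Lp.memLp f).2.ne) ?_
      refine (eLpNorm_le_mul_eLpNorm_of_ae_le_mul (c := C) (g := sphereMean f)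
        (Filter.Eventually.of_forall fun p => ?_) 2).trans ?_
      · rw [norm_mul]; gcongr; exact hC _
      · gcongr; exact (sphereMean_bound f).2

/-- From the heavy and light momenta `(K, k)` to the displacement and center-of-mass momenta
`k_d = k / (1 + λ) - λ K / (1 + λ)` and `K_cm = k + K` (see `toCM_eq`). -/
def toCM (lam : ℝ) (p : Mom n × Mom n) : Mom n × Mom n :=
  (p.2 - (lam / (1 + lam)) • (p.1 + p.2), p.1 + p.2)

/-- The inverse of `toCM`: from `(k_d, K_cm)` to `(K, k)`. -/
def ofCM (lam : ℝ) (q : Mom n × Mom n) : Mom n × Mom n :=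
  (q.2 - (q.1 + (lam / (1 + lam)) • q.2), q.1 + (lam / (1 + lam)) • q.2)

lemma measurePreserving_shear {g : Mom n → Mom n} (hg : Measurable g) :
    MeasurePreserving (fun p : Mom n × Mom n => (p.1, p.2 + g p.1)) volume volume :=
  (MeasurePreserving.id (volume : Measure (Mom n))).skew_product
    (g := fun a b => b + g a) (by unfold Function.uncurry; fun_prop)
    (Filter.Eventually.of_forall fun a => (measurePreserving_add_right volume (g a)).map_eq)

lemma measurePreserving_toCM (lam : ℝ) : MeasurePreserving (toCM (n := n) lam) volume volume := by
  have hs : MeasurePreserving (Prod.swap : Mom n × Mom n → _) volume volume :=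
    Measure.measurePreserving_swap
  have h1 := measurePreserving_shear (n := n) (g := fun x => x) measurable_id
  have h2 := measurePreserving_shear (n := n) (g := fun x => -((lam / (1 + lam)) • x))
    (by fun_prop)
  convert hs.comp (h2.comp (hs.comp (h1.comp hs))) using 1
  funext p
  simp [toCM, sub_eq_add_neg]

lemma measurePreserving_ofCM (lam : ℝ) : MeasurePreserving (ofCM (n := n) lam) volume volume := by
  have hs : MeasurePreserving (Prod.swap : Mom n × Mom n → _) volume volume :=
    Measure.measurePreserving_swap
  have h1 := measurePreserving_shear (n := n) (g := fun x => -x) (by fun_prop)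
  have h2 := measurePreserving_shear (n := n) (g := fun x => (lam / (1 + lam)) • x)
    (by fun_prop)
  convert hs.comp (h1.comp (hs.comp (h2.comp hs))) using 1
  funext p
  simp [ofCM, sub_eq_add_neg]

lemma ofCM_toCM (lam : ℝ) (p : Mom n × Mom n) : ofCM lam (toCM lam p) = p := by
  simp [ofCM, toCM]

lemma toCM_ofCM (lam : ℝ) (p : Mom n × Mom n) : toCM lam (ofCM lam p) = p := by
  simp [ofCM, toCM]

lemma toCM_eq {lam : ℝ} (h : 0 < lam) (K k : Mom n) :
    toCM lam (K, k) = ((1 / (1 + lam)) • k - (lam / (1 + lam)) • K, k + K) := by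
  have h' : 1 + lam ≠ 0 := by positivity
  refine Prod.ext ?_ (add_comm _ _)
  ext i
  simp [toCM]
  field_simp
  ring

/-- The scattering operator `S_λ = I + I_cm ⊗ (S_λ(|k_d|) ⊗ |φ⟩⟨φ|)` on the two-particle space. -/
def scatteringOp [NeZero n] (a lam : ℝ) : L2Pair n →L[ℂ] L2Pair n :=
  1 + (Lp.compMeasurePreservingₗᵢ ℂ (toCM lam)
      (measurePreserving_toCM lam)).toContinuousLinearMap ∘L
    radialOp (scatteringCoeff n a lam) (measurable_scatteringCoeff n a lam) 2
      (norm_scatteringCoeff_le n a lam) ∘L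
    (Lp.compMeasurePreservingₗᵢ ℂ (ofCM lam)
      (measurePreserving_ofCM lam)).toContinuousLinearMap

/-- `A_λ = S_λ - I`. -/
def scatteringA [NeZero n] (a lam : ℝ) : L2Pair n →L[ℂ] L2Pair n := scatteringOp a lam - 1

/-! ### The normalized Haar measure of the rotation group -/

/-- The group `SO_n`. -/
abbrev SO (n : ℕ) := Matrix.specialOrthogonalGroup (Fin n) ℝ


instance (n : ℕ) : IsTopologicalGroup (SO n) where
  continuous_inv := by
    refine continuous_induced_rng.2 ?_
    exact (continuous_subtype_val (p := fun x => x ∈ SO n)).matrix_transpose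

instance (n : ℕ) : CompactSpace (SO n) := by
  refine (isCompact_iff_compactSpace (s := ((SO n : Submonoid _) :
    Set (Matrix (Fin n) (Fin n) ℝ)))).1 ?_
  have hcl : IsClosed {A : Matrix (Fin n) (Fin n) ℝ | A * A.transpose = 1 ∧ A.det = 1} :=
    (isClosed_eq (by fun_prop) continuous_const).inter
      (isClosed_eq (by fun_prop) continuous_const)
  have hK : IsCompact (Set.pi Set.univ fun _ : Fin n => Set.pi Set.univ fun _ : Fin n =>
      Set.Icc (-1 : ℝ) 1) :=
    isCompact_univ_pi fun _ => isCompact_univ_pi fun _ => isCompact_Icc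
  have : ((SO n : Submonoid _) : Set (Matrix (Fin n) (Fin n) ℝ)) =
      {A : Matrix (Fin n) (Fin n) ℝ | A * A.transpose = 1 ∧ A.det = 1} := by
    ext A
    simp only [SetLike.mem_coe, Matrix.mem_specialOrthogonalGroup_iff,
      Matrix.mem_orthogonalGroup_iff, Set.mem_ofPred_eq]
  rw [this]
  refine IsCompact.of_isClosed_subset hK hcl ?_
  intro A hA i _ j _
  have h := entry_norm_bound_of_unitary (𝕜 := ℝ) (U := A)
    ((Matrix.mem_unitaryGroup_iff).2 hA.1) i j
  exact abs_le.1 h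

instance (n : ℕ) : MeasurableSpace (SO n) := borel _
instance (n : ℕ) : BorelSpace (SO n) := ⟨rfl⟩

/-- The normalized Haar measure of `SO_n`, as a measure on the linear maps of `ℝⁿ`. In dimension one it
is, by convention, the uniform probability measure on `{+1, -1}`. -/
def rotationMeasure (n : ℕ) : Measure (Mom n →L[ℝ] Mom n) :=
  if n = 1 then
    (2⁻¹ : ENNReal) • (Measure.dirac (ContinuousLinearMap.id ℝ _) +
      Measure.dirac (-ContinuousLinearMap.id ℝ _))
  else
    (Measure.haarMeasure (⊤ : TopologicalSpace.PositiveCompacts (SO n))).map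
      fun σ => Matrix.toEuclideanCLM (𝕜 := ℝ) σ.1


lemma measurable_toCLM (n : ℕ) :
    Measurable fun σ : SO n => Matrix.toEuclideanCLM (𝕜 := ℝ) σ.1 := by
  have h : Continuous fun A : Matrix (Fin n) (Fin n) ℝ =>
      (Matrix.toEuclideanCLM (n := Fin n) (𝕜 := ℝ) A) :=
    (Matrix.toEuclideanCLM (n := Fin n) (𝕜 := ℝ)).toAlgEquiv.toLinearMap.continuous_of_finiteDimensional
  exact (h.comp continuous_subtype_val).measurable

instance (n : ℕ) : IsProbabilityMeasure (rotationMeasure n) := by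
  unfold rotationMeasure
  split_ifs with h
  · constructor
    simp
    exact ENNReal.inv_two_add_inv_two
  · have : IsProbabilityMeasure
        (Measure.haarMeasure (⊤ : TopologicalSpace.PositiveCompacts (SO n))) :=
      ⟨by simpa using Measure.haarMeasure_self (K₀ := (⊤ : TopologicalSpace.PositiveCompacts (SO n)))⟩
    exact Measure.isProbabilityMeasure_map (measurable_toCLM n).aemeasurable

/-! ### Integral kernels and strongly convergent integrals of operators -/

/-- `r` is an integral kernel of `ρ` in the momentum representation:
`(ρ ψ)(k) = ∫ r(k, k') ψ(k') dk'`. -/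
def IsMomentumKernel (ρ : L2 n →L[ℂ] L2 n) (r : Mom n → Mom n → ℂ) : Prop :=
  ∀ ψ : L2 n, ∀ᵐ k, Integrable (fun k' => r k k' * ψ k') ∧ ρ ψ k = ∫ k', r k k' * ψ k'

/-- The operator `τ_a`, translation by `a` of wave functions in momentum space. Its adjoint (inverse)
is `τ_a^* = τ_{-a}`. -/
def translation (a : Mom n) (f : Mom n → ℂ) : Mom n → ℂ := fun P => f (P - a)

/-- The multiplication operator `p_{k,σ,λ} = ρ((1 + λ) k + λ P, (σ + λ) k + λ P)`, where `r` is the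
kernel of `ρ`. -/
def multiplierP (r : Mom n → Mom n → ℂ) (lam : ℝ) (k : Mom n) (σ : Mom n →L[ℝ] Mom n)
    (f : Mom n → ℂ) : Mom n → ℂ :=
  fun P => r ((1 + lam) • k + lam • P) (σ k + lam • k + lam • P) * f P

/-- The integrand `τ_k τ_{σk}^* p_{k,σ,λ} \bar S_λ(|k|)`, acting on wave functions. -/
def integrand (r : Mom n → Mom n → ℂ) (a lam : ℝ) (ω : Mom n × (Mom n →L[ℝ] Mom n))
    (f : Mom n → ℂ) : Mom n → ℂ :=
  translation ω.1 (translation (-(ω.2 ω.1)) (multiplierP r lam ω.1 ω.2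
    fun P => (starRingEnd ℂ) (scatteringCoeff n a lam ‖ω.1‖) * f P))

/-- `B = ∫ T_ω dμ(ω)` as a strongly convergent integral of operators on `L²(ℝⁿ)`.

For every measurable set `E` of parameters the partial integral `D E = ∫_E T_ω dμ(ω)` exists as a
bounded operator (acting on each `ψ ∈ L²` by integrals `∫_E (T_ω ψ)(P) dμ(ω)` that converge absolutely
for almost every `P`), and along every exhaustion of the parameter space by measurable sets the
partial integrals converge to `B` in the strong operator topology. The operators `T_ω` need not be
bounded one by one. -/
def IsStrongIntegral {Ω : Type*} [MeasurableSpace Ω] (μ : Measure Ω)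
    (T : Ω → (Mom n → ℂ) → Mom n → ℂ) (B : L2 n →L[ℂ] L2 n) : Prop :=
  ∃ D : Set Ω → L2 n →L[ℂ] L2 n,
    (∀ E, MeasurableSet E → ∀ ψ : L2 n, ∀ᵐ P,
      IntegrableOn (fun ω => T ω ψ P) E μ ∧ D E ψ P = ∫ ω in E, T ω ψ P ∂μ) ∧
    ∀ E : ℕ → Set Ω, (∀ N, MeasurableSet (E N)) → Monotone E → ⋃ N, E N = Set.univ →
      ∀ ψ : L2 n, Tendsto (fun N => D (E N) ψ) atTop (𝓝 (B ψ))

end PointScattering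

end

open PointScattering

/-!
Write `ρ = ∑ⱼ |fⱼ⟩⟨gⱼ|`, rescaled so that `∑ ‖fⱼ‖²` and `∑ ‖gⱼ‖²` are finite
(`IsTraceClass.exists_expansion`), and let `A` be the operator `scatteringA`. The partial trace of
`(I ⊗ ρ) A^*` then has the matrix elements `∑ⱼ ⟨A (w ⊗ gⱼ), v ⊗ fⱼ⟩` (`hasSum_trace`), so everything
rests on the sesquilinear form of `A`, and no formula for `A^*` is needed.

In the displacement and center-of-mass momenta `(k, c)` the form `⟨A U, V⟩` is the integral of
`\bar S(|k|) \bar U V`, with `V` evaluated at `k` and `U` averaged over the sphere through `k`. A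
random rotation moves `k` to a uniformly distributed point of that sphere (`map_rotation_apply`), so
the average becomes an integral over `σ` of `U` at `σ k`. Substituting `c = (1 + λ) (P + σ k)`, where
`P` is the heavy momentum in the argument of `U`, gives `inner_scatteringA`, with the Jacobian
`(1 + λ)^n`. For `U = w ⊗ gⱼ` and `V = v ⊗ fⱼ` the integrand contains `fⱼ(x) \bar gⱼ(y)` at light
momenta `x` and `y` depending on `(P, k, σ)`, and the sum over `j` of these products is `r(x, y)`.

The last point is delicate. The map `(P, k, σ) ↦ (x, y)` may be singular (in dimension one `x = y`
for the half of the parameters with `σ = 1`), so an identity for almost every pair `(x, y)` is of no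
use. But `x` and `y` have nonsingular laws separately, and `hasSum_kernel` gives the expansion of `r`
for all `x` and all `y` outside two null sets: for a continuous kernel it holds at all Lebesgue points
of the `ℓ²`-valued functions `(fⱼ)` and `(gⱼ)`.

It also follows that `|r(x, y)|² ≤ φ(x) γ(y)` with integrable `φ = ∑ |fⱼ|²` and `γ = ∑ |gⱼ|²`. By
Cauchy–Schwarz, the part over `E` of the integral, applied to `ψ` and taken at `P`, is bounded by the
square root of `∫ γ(y) · ∫_E φ(x) |ψ(K')|²`, up to a constant, where the first factor does not depend
on `P` and the second is integrable in `(P, k, σ)`, as `(P, k) ↦ (K', x)` has Jacobian `(1 + λ)^n`. This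
gives the bounded partial integrals and their strong convergence (`KernelBound.isStrongIntegral`).
-/

noncomputable section

namespace PointScattering

open scoped ENNReal

variable {n : ℕ}

/-! ### The kernel of a trace class operator -/

/-- The sequence space `ℓ²(ℕ)`. -/
abbrev SeqL2 := lp (fun _ : ℕ => ℂ) 2

lemma lintegral_enorm_sq {α : Type*} [MeasurableSpace α] {μ : Measure α} (f : Lp ℂ 2 μ) :
    ∫⁻ x, ‖f x‖ₑ ^ 2 ∂μ = ‖f‖ₑ ^ 2 := by
  have h := eLpNorm_eq_lintegral_rpow_enorm_toReal (μ := μ) (f := f)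
    two_ne_zero ENNReal.ofNat_ne_top
  rw [Lp.enorm_def, h, ← ENNReal.rpow_natCast, ← ENNReal.rpow_mul]
  simp

lemma tsum_enorm_sq_ne_top {f : ℕ → L2 n} (hf : Summable fun j => ‖f j‖ ^ 2) :
    ∑' j, ‖f j‖ₑ ^ 2 ≠ ∞ := by
  simp_rw [← ofReal_norm, ← ENNReal.ofReal_pow (norm_nonneg _)]
  rw [← ENNReal.ofReal_tsum_of_nonneg (fun _ => by positivity) hf]
  exact ENNReal.ofReal_ne_top

lemma lintegral_tsum_enorm_sq {f : ℕ → L2 n} (hf : Summable fun j => ‖f j‖ ^ 2) :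
    ∫⁻ x, ∑' j, ‖f j x‖ₑ ^ 2 ≠ ∞ := by
  rw [lintegral_tsum fun j => ((Lp.stronglyMeasurable (f j)).enorm.pow_const _).aemeasurable]
  simp_rw [lintegral_enorm_sq]
  exact tsum_enorm_sq_ne_top hf

lemma measurable_tsum_enorm_sq (f : ℕ → L2 n) : Measurable fun x => ∑' j, ‖f j x‖ₑ ^ 2 :=
  Measurable.tsum fun j => (Lp.stronglyMeasurable (f j)).enorm.pow_const _

/-- A square summable sequence of `L²` functions is one square integrable function with values in
`ℓ²`. -/
lemma exists_memLp_seqL2 (f : ℕ → L2 n) (hf : Summable fun j => ‖f j‖ ^ 2) :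
    ∃ F : Mom n → SeqL2, MemLp F 2 volume ∧ ∀ᵐ x, ∀ j, F x j = f j x := by
  classical
  have hfin := lintegral_tsum_enorm_sq hf
  have hae : ∀ᵐ x, Memℓp (fun j => f j x) 2 := by
    filter_upwards [ae_lt_top (measurable_tsum_enorm_sq f) hfin] with x hx
    refine memℓp_gen ?_
    have h2 : Summable fun j => ‖f j x‖₊ ^ 2 := by
      rw [← ENNReal.tsum_coe_ne_top_iff_summable]
      simpa only [ENNReal.coe_pow, enorm_eq_nnnorm] using hx.ne
    have h3 := NNReal.summable_coe.2 h2
    simpa using h3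
  let F : Mom n → SeqL2 := fun x => if h : Memℓp (fun j => f j x) 2 then ⟨_, h⟩ else 0
  have hF : ∀ᵐ x, ∀ j, F x j = f j x := by
    filter_upwards [hae] with x hx j
    simp [F, hx]
  have hFm : AEStronglyMeasurable F volume := by
    refine aestronglyMeasurable_of_tendsto_ae atTop
      (f := fun N x => ∑ j ∈ Finset.range N, lp.single 2 j (f j x)) (fun N => ?_) ?_
    · refine Finset.aestronglyMeasurable_fun_sum _ fun j _ => ?_
      exact (lp.singleContinuousLinearMap ℂ (fun _ : ℕ => ℂ) 2 j).continuous.comp_aestronglyMeasurable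
        (Lp.aestronglyMeasurable (f j))
    · filter_upwards [hF] with x hx
      have := (lp.hasSum_single (by simp) (F x)).tendsto_sum_nat
      simpa only [hx] using this
  refine ⟨F, ⟨hFm, ?_⟩, hF⟩
  rw [eLpNorm_lt_top_iff_lintegral_rpow_enorm_lt_top two_ne_zero ENNReal.ofNat_ne_top]
  refine lt_of_eq_of_lt (lintegral_congr_ae ?_) hfin.lt_top
  filter_upwards [hF] with x hx
  have h := lp.hasSum_norm (p := 2) (by simp) (F x)
  simp only [ENNReal.toReal_ofNat, Real.rpow_ofNat, hx] at h
  rw [← ofReal_norm, ENNReal.toReal_ofNat, ENNReal.rpow_ofNat,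
    ← ENNReal.ofReal_pow (norm_nonneg _), ← h.tsum_eq, ENNReal.ofReal_tsum_of_nonneg (fun _ => by positivity) h.summable]
  simp [ENNReal.ofReal_pow]

lemma setIntegral_seqL2_apply {F : Mom n → SeqL2} (hF : MemLp F 2 volume) {f : ℕ → L2 n}
    (hf : ∀ᵐ x, ∀ j, F x j = f j x) {A : Set (Mom n)} (hA : volume A ≠ ∞) (j : ℕ) :
    (∫ x in A, F x) j = ∫ x in A, f j x := by
  have : IsFiniteMeasure (volume.restrict A) := ⟨by simpa using hA.lt_top⟩
  have hi : Integrable F (volume.restrict A) := (hF.restrict A).integrable one_le_two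
  have h := (lp.evalCLM ℂ (fun _ : ℕ => ℂ) 2 j).integral_comp_comm hi
  change _ = (∫ x in A, F x) j at h
  rw [← h]
  refine integral_congr_ae (ae_restrict_of_ae ?_)
  filter_upwards [hf] with x hx
  exact hx j

/-- The mean of an expanded operator over a product of two sets, computed in `ℓ²`. -/
lemma inner_setIntegral_seqL2 {ρ : L2 n →L[ℂ] L2 n} {f g : ℕ → L2 n}
    (hρ : ∀ ψ, HasSum (fun j => inner ℂ (g j) ψ • f j) (ρ ψ))
    {F G : Mom n → SeqL2} (hF : MemLp F 2 volume) (hFf : ∀ᵐ x, ∀ j, F x j = f j x)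
    (hG : MemLp G 2 volume) (hGg : ∀ᵐ x, ∀ j, G x j = g j x)
    {A B : Set (Mom n)} (hA : MeasurableSet A) (hA' : volume A ≠ ∞) (hB : MeasurableSet B)
    (hB' : volume B ≠ ∞) :
    inner ℂ (∫ y in B, G y) (∫ x in A, F x) =
      ∫ x in A, ρ (indicatorConstLp 2 hB hB' 1) x := by
  have h1 := (hρ (indicatorConstLp 2 hB hB' 1)).mapL
    (innerSL ℂ (indicatorConstLp 2 hA hA' (1 : ℂ)))
  simp only [innerSL_apply_apply, inner_smul_right, L2.inner_indicatorConstLp_one] at h1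
  refine (lp.hasSum_inner _ _).unique ?_
  convert h1 using 2 with j
  rw [setIntegral_seqL2_apply hF hFf hA', setIntegral_seqL2_apply hG hGg hB', RCLike.inner_apply,
    ← inner_conj_symm (g j), L2.inner_indicatorConstLp_one, mul_comm]

lemma ae_tendsto_ball_average {E : Type*} [NormedAddCommGroup E] [NormedSpace ℝ E]
    [CompleteSpace E] {F : Mom n → E} (hF : LocallyIntegrable F volume) :
    ∀ᵐ x, Tendsto (fun ε => ⨍ y in Metric.closedBall x ε, F y) (𝓝[>] 0) (𝓝 (F x)) := by
  filter_upwards [IsUnifLocDoublingMeasure.ae_tendsto_average volume hF 1] with x hx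
  refine hx (fun _ : ℝ => x) id tendsto_id ?_
  filter_upwards [self_mem_nhdsWithin] with ε hε
  exact Metric.mem_closedBall_self (by simpa using (le_of_lt hε))

/-- A continuous kernel of `∑ⱼ |fⱼ⟩⟨gⱼ|` equals `∑ⱼ fⱼ(x) \bar gⱼ(y)` for all `x` and all `y` outside
two null sets of `ℝⁿ`, in particular at almost every point of the diagonal. The mean of the kernel over
a product of two small balls is the inner product in `ℓ²` of the means of `(fⱼ)` and `(gⱼ)`, which
converge at Lebesgue points. -/
lemma hasSum_kernel {ρ : L2 n →L[ℂ] L2 n} {f g : ℕ → L2 n}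
    (hf : Summable fun j => ‖f j‖ ^ 2) (hg : Summable fun j => ‖g j‖ ^ 2)
    (hρ : ∀ ψ, HasSum (fun j => inner ℂ (g j) ψ • f j) (ρ ψ))
    {r : Mom n → Mom n → ℂ} (hr : Continuous (Function.uncurry r)) (hker : IsMomentumKernel ρ r) :
    ∃ p q : Mom n → Prop, (∀ᵐ x, p x) ∧ (∀ᵐ y, q y) ∧ ∀ x y, p x → q y →
      HasSum (fun j => f j x * (starRingEnd ℂ) (g j y)) (r x y) := by
  obtain ⟨F, hF, hFf⟩ := exists_memLp_seqL2 f hf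
  obtain ⟨G, hG, hGg⟩ := exists_memLp_seqL2 g hg
  have hLF := ae_tendsto_ball_average (hF.locallyIntegrable one_le_two)
  have hLG := ae_tendsto_ball_average (hG.locallyIntegrable one_le_two)
  refine ⟨_, _, hFf.and hLF, hGg.and hLG, ?_⟩
  rintro x y ⟨hx, hx'⟩ ⟨hy, hy'⟩
  have hsum := lp.hasSum_inner (𝕜 := ℂ) (G y) (F x)
  simp only [RCLike.inner_apply, hx, hy] at hsum
  suffices key : r x y = inner ℂ (G y) (F x) by rwa [key]
  -- both sides are limits of the mean of `r` over products of small balls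
  have hlim := hy'.inner (𝕜 := ℂ) hx'
  refine tendsto_nhds_unique ?_ hlim
  rw [Metric.tendsto_nhds]
  intro η hη
  obtain ⟨δ, hδ, hδr⟩ := Metric.continuousAt_iff.1 (hr.continuousAt (x := (x, y))) (η / 2)
    (half_pos hη)
  filter_upwards [Ioo_mem_nhdsGT hδ] with ε hε
  set A := Metric.closedBall x ε
  set B := Metric.closedBall y ε
  have hA : MeasurableSet A := measurableSet_closedBall
  have hB : MeasurableSet B := measurableSet_closedBall
  have hA0 : volume A ≠ 0 := (Metric.measure_closedBall_pos volume x hε.1).ne'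
  have hB0 : volume B ≠ 0 := (Metric.measure_closedBall_pos volume y hε.1).ne'
  have hA' : volume A ≠ ∞ := measure_closedBall_lt_top.ne
  have hB' : volume B ≠ ∞ := measure_closedBall_lt_top.ne
  set v := ρ (indicatorConstLp 2 hB hB' 1) with hv
  have hvr : ∀ᵐ x', (volume.real B)⁻¹ • v x' = ⨍ y' in B, r x' y' := by
    filter_upwards [hker (indicatorConstLp 2 hB hB' 1)] with x' hx'
    rw [setAverage_eq, hv, hx'.2, ← integral_indicator hB]
    congr 1
    refine integral_congr_ae ?_
    filter_upwards [indicatorConstLp_coeFn (μ := volume) (p := 2) (hs := hB) (hμs := hB')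
      (c := (1 : ℂ))] with y' hy'
    rw [hy']
    by_cases h : y' ∈ B <;> simp [h]
  have hmean : inner ℂ (⨍ y' in B, G y') (⨍ x' in A, F x') =
      ⨍ x' in A, (volume.real B)⁻¹ • v x' := by
    rw [setAverage_eq, setAverage_eq, setAverage_eq, integral_smul,
      ← inner_setIntegral_seqL2 hρ hF hFf hG hGg hA hA' hB hB',
      inner_smul_left_eq_smul,
      inner_smul_right_eq_smul, smul_comm]
  have hrB : ∀ x' ∈ A, ⨍ y' in B, r x' y' ∈ Metric.closedBall (r x y) (η / 2) := fun x' hx' => by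
    refine (convex_closedBall _ _).set_average_mem Metric.isClosed_closedBall hB0 hB' ?_ ?_
    · filter_upwards [ae_restrict_mem hB] with y' hy'
      refine (hδr (x := (x', y')) (max_lt ?_ ?_)).le
      · exact lt_of_le_of_lt hx' hε.2
      · exact lt_of_le_of_lt hy' hε.2
    · have : Continuous (r x') := hr.comp (by fun_prop : Continuous fun y' => (x', y'))
      exact this.continuousOn.integrableOn_compact (isCompact_closedBall _ _)
  have hmem : ⨍ x' in A, (volume.real B)⁻¹ • v x' ∈ Metric.closedBall (r x y) (η / 2) := by
    refine (convex_closedBall _ _).set_average_mem Metric.isClosed_closedBall hA0 hA' ?_ ?_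
    · filter_upwards [ae_restrict_mem hA, ae_restrict_of_ae hvr] with x' hx' hvx
      rw [hvx]
      exact hrB x' hx'
    · have : IsFiniteMeasure (volume.restrict A) := ⟨by simpa using hA'.lt_top⟩
      exact (((Lp.memLp v).restrict A).integrable one_le_two).smul
        (volume.real B)⁻¹
  rw [hmean]
  exact lt_of_le_of_lt hmem (half_lt_self hη)

/-! ### Random rotations and the unit sphere -/

lemma norm_toEuclideanCLM_of_mem {A : Matrix (Fin n) (Fin n) ℝ} (hA : A ∈ SO n) (x : Mom n) :
    ‖Matrix.toEuclideanCLM (𝕜 := ℝ) A x‖ = ‖x‖ := by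
  have hA' := (Matrix.mem_specialOrthogonalGroup_iff.1 hA).1
  replace hA' : star A * A = 1 := (Matrix.mem_orthogonalGroup_iff' _ _).1 hA'
  refine (ContinuousLinearMap.norm_map_iff_adjoint_comp_self _).2 ?_ x
  rw [← ContinuousLinearMap.star_eq_adjoint, ← map_star]
  change Matrix.toEuclideanCLM (𝕜 := ℝ) (star A) * Matrix.toEuclideanCLM (𝕜 := ℝ) A = 1
  rw [← map_mul, hA', map_one]

lemma ae_norm_map_rotation (n : ℕ) : ∀ᵐ σ ∂rotationMeasure n, ∀ x, ‖σ x‖ = ‖x‖ := by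
  unfold rotationMeasure
  split_ifs with h
  · refine Measure.ae_smul_measure (ae_add_measure_iff.2 ?_) _
    simp [ae_dirac_eq]
  · have hc : IsClosed {σ : Mom n →L[ℝ] Mom n | ∀ x, ‖σ x‖ = ‖x‖} := by
      simp only [Set.ofPred_forall]
      exact isClosed_iInter fun x => isClosed_eq (by fun_prop) continuous_const
    rw [ae_map_iff (measurable_toCLM n).aemeasurable hc.measurableSet]
    exact Eventually.of_forall fun σ => norm_toEuclideanCLM_of_mem σ.2

lemma measurePreserving_of_norm_map {σ : Mom n →L[ℝ] Mom n} (h : ∀ x, ‖σ x‖ = ‖x‖) :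
    MeasurePreserving σ volume volume :=
  (LinearIsometry.toLinearIsometryEquiv ⟨σ.toLinearMap, h⟩ rfl).measurePreserving

/-- One reflection maps `u` to `v`; a second one, which fixes `u`, makes the determinant positive. -/
lemma exists_isometry_det_one (hn : 2 ≤ n) {u v : Mom n} (hu : ‖u‖ = 1) (hv : ‖v‖ = 1) :
    ∃ R : Mom n ≃ₗᵢ[ℝ] Mom n, R u = v ∧ LinearMap.det R.toLinearMap = 1 := by
  by_cases huv : u = v
  · exact ⟨LinearIsometryEquiv.refl ℝ _, huv, LinearMap.det_id⟩
  have hdet : ∀ w : Mom n, w ≠ 0 →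
      LinearMap.det (Submodule.reflection (Submodule.span ℝ {w})ᗮ).toLinearMap = -1 := fun w hw => by
    rw [Submodule.det_reflection, Submodule.orthogonal_orthogonal, finrank_span_singleton hw,
      pow_one]
  obtain ⟨z, hz, hz0⟩ : ∃ z ∈ (Submodule.span ℝ {u})ᗮ, z ≠ 0 := by
    refine Submodule.exists_mem_ne_zero_of_ne_bot fun hbot => ?_
    have h := (Submodule.span ℝ {u}).finrank_add_finrank_orthogonal
    rw [hbot, finrank_span_singleton (by rintro rfl; simp at hu), finrank_bot,
      finrank_euclideanSpace_fin] at h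
    omega
  refine ⟨(Submodule.reflection (Submodule.span ℝ {z})ᗮ).trans
    (Submodule.reflection (Submodule.span ℝ {u - v})ᗮ), ?_, ?_⟩
  · have hfix : Submodule.reflection (Submodule.span ℝ {z})ᗮ u = u := by
      refine Submodule.reflection_mem_subspace_eq_self ?_
      rw [Submodule.mem_orthogonal_singleton_iff_inner_left]
      exact Submodule.mem_orthogonal_singleton_iff_inner_right.1 hz
    rw [LinearIsometryEquiv.trans_apply, hfix]
    exact Submodule.reflection_sub (hu.trans hv.symm)
  · have := LinearMap.det_comp
      (Submodule.reflection (Submodule.span ℝ {u - v})ᗮ).toLinearMap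
      (Submodule.reflection (Submodule.span ℝ {z})ᗮ).toLinearMap
    rw [hdet _ hz0, hdet _ (sub_ne_zero.2 huv)] at this
    refine Eq.trans ?_ (this.trans (by norm_num))
    rfl

/-- `SO_n` acts transitively on the unit sphere when `2 ≤ n`. -/
lemma exists_SO_map_eq (hn : 2 ≤ n) {u v : Mom n} (hu : ‖u‖ = 1) (hv : ‖v‖ = 1) :
    ∃ τ : SO n, Matrix.toEuclideanCLM (𝕜 := ℝ) τ.1 u = v := by
  obtain ⟨R, hR, hdet⟩ := exists_isometry_det_one hn hu hv
  set T : Mom n →L[ℝ] Mom n := R.toLinearIsometry.toContinuousLinearMap with hT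
  set A := (Matrix.toEuclideanCLM (n := Fin n) (𝕜 := ℝ)).symm T with hA
  have hAT : Matrix.toEuclideanCLM (n := Fin n) (𝕜 := ℝ) A = T := by simp [hA]
  refine ⟨⟨A, Matrix.mem_specialOrthogonalGroup_iff.2 ⟨?_, ?_⟩⟩, ?_⟩
  · rw [Matrix.mem_orthogonalGroup_iff']
    change star A * A = 1
    refine (Matrix.toEuclideanCLM (n := Fin n) (𝕜 := ℝ)).injective ?_
    change Matrix.toEuclideanCLM (n := Fin n) (𝕜 := ℝ) (star A * A) =
      Matrix.toEuclideanCLM (n := Fin n) (𝕜 := ℝ) 1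
    rw [map_mul, map_star, hAT, map_one]
    exact (ContinuousLinearMap.norm_map_iff_adjoint_comp_self T).1 R.norm_map
  · rw [← hdet, ← LinearMap.det_toLin (PiLp.basisFun 2 ℝ (Fin n)), ← Matrix.toLpLin_eq_toLin]
    congr 1
    ext1 x
    exact congrArg (fun S : Mom n →L[ℝ] Mom n => S x) hAT
  · change Matrix.toEuclideanCLM (n := Fin n) (𝕜 := ℝ) A u = v
    rw [hAT]; exact hR

/-- A right translate of the normalized Haar measure of the compact group `SO_n` is again a normalized
Haar measure, hence equal to it. -/
instance (n : ℕ) : (Measure.haarMeasure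
    (⊤ : TopologicalSpace.PositiveCompacts (SO n))).IsMulRightInvariant := by
  set μ := Measure.haarMeasure (⊤ : TopologicalSpace.PositiveCompacts (SO n))
  have hμ : IsProbabilityMeasure μ :=
    ⟨by simpa using Measure.haarMeasure_self (K₀ := (⊤ : TopologicalSpace.PositiveCompacts (SO n)))⟩
  refine ⟨fun g => ?_⟩
  have := Measure.isProbabilityMeasure_map (μ := μ) (f := (· * g)) (by fun_prop)
  exact Measure.isHaarMeasure_eq_of_isProbabilityMeasure _ _

lemma map_rotation_eq_of_norm_eq_one {u v : Mom n} (hu : ‖u‖ = 1) (hv : ‖v‖ = 1) :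
    (rotationMeasure n).map (fun σ => σ u) = (rotationMeasure n).map (fun σ => σ v) := by
  have hm : ∀ x : Mom n, Measurable fun σ : Mom n →L[ℝ] Mom n => σ x := fun x => by fun_prop
  rcases Nat.lt_or_ge n 2 with h | h
  · interval_cases n
    · simp [Subsingleton.elim u 0] at hu
    · have huv : u = v ∨ u = -v := by
        have hu' : |u 0| = 1 := by simpa [EuclideanSpace.norm_eq, Real.sqrt_sq_eq_abs] using hu
        have hv' : |v 0| = 1 := by simpa [EuclideanSpace.norm_eq, Real.sqrt_sq_eq_abs] using hv
        rcases abs_eq_abs.1 (hu'.trans hv'.symm) with h | h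
        · left; ext i; fin_cases i; exact h
        · right; ext i; fin_cases i; exact h
      rcases huv with rfl | rfl
      · rfl
      · simp only [rotationMeasure, if_true, Measure.map_smul]
        rw [Measure.map_add _ _ (hm _), Measure.map_add _ _ (hm _), Measure.map_dirac' (hm _),
          Measure.map_dirac' (hm _), Measure.map_dirac' (hm _), Measure.map_dirac' (hm _), add_comm]
        simp
  · obtain ⟨τ, hτ⟩ := exists_SO_map_eq h hu hv
    rw [rotationMeasure, if_neg (by omega), Measure.map_map (hm _) (measurable_toCLM n),
      Measure.map_map (hm _) (measurable_toCLM n)]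
    conv_lhs => rw [← map_mul_right_eq_self
      (Measure.haarMeasure (⊤ : TopologicalSpace.PositiveCompacts (SO n))) τ]
    rw [Measure.map_map ((hm _).comp (measurable_toCLM n)) (by fun_prop)]
    congr 1
    funext σ
    simp only [Function.comp_apply, Submonoid.coe_mul, map_mul, ← hτ]
    rfl

lemma lintegral_sphereMeasure_comp [NeZero n] {σ : Mom n →L[ℝ] Mom n} (hσ : ∀ x, ‖σ x‖ = ‖x‖)
    {h : Mom n → ℝ≥0∞} (hh : Measurable h) :
    ∫⁻ ω, h (σ ω.1) ∂(sphereMeasure n) = ∫⁻ ω, h ω.1 ∂(sphereMeasure n) := by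
  -- both sides are, up to the same constant, integrals over the unit ball
  have key : ∀ k : Mom n → ℝ≥0∞, Measurable k →
      ∫⁻ x, (Metric.ball 0 1).indicator (fun x => k (‖x‖⁻¹ • x)) x =
        (∫⁻ ω, k ω.1 ∂(volume : Measure (Mom n)).toSphere) *
          ENNReal.ofReal (1 / n) := fun k hk => by
    rw [lintegral_polar (Measurable.indicator (by fun_prop) measurableSet_ball)]
    have hr : ∀ (r : Set.Ioi (0 : ℝ)) (ω : USphere n),
        (Metric.ball 0 1).indicator (fun x => k (‖x‖⁻¹ • x)) (r.1 • ω.1) =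
          (Set.Iio (⟨1, Set.mem_Ioi.2 zero_lt_one⟩ : Set.Ioi (0 : ℝ))).indicator (fun _ => k ω.1) r := by
      intro r ω
      have hr0 : (0 : ℝ) < r.1 := r.2
      have hω : ‖(ω.1 : Mom n)‖ = 1 := mem_sphere_zero_iff_norm.1 ω.2
      have hn : ‖r.1 • (ω.1 : Mom n)‖ = r.1 := by
        rw [norm_smul, hω, mul_one, Real.norm_of_nonneg hr0.le]
      have hmem : r.1 • (ω.1 : Mom n) ∈ Metric.ball (0 : Mom n) 1 ↔
          r ∈ Set.Iio (⟨1, Set.mem_Ioi.2 zero_lt_one⟩ : Set.Ioi (0 : ℝ)) := by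
        rw [mem_ball_zero_iff, hn, Set.mem_Iio, ← Subtype.coe_lt_coe]
      by_cases h : r ∈ Set.Iio (⟨1, Set.mem_Ioi.2 zero_lt_one⟩ : Set.Ioi (0 : ℝ))
      · rw [Set.indicator_of_mem h, Set.indicator_of_mem (hmem.2 h), hn,
          inv_smul_smul₀ hr0.ne']
      · rw [Set.indicator_of_notMem h, Set.indicator_of_notMem (mt hmem.1 h)]
    simp_rw [hr]
    have : ∀ r : Set.Ioi (0 : ℝ), ∫⁻ ω : USphere n,
        (Set.Iio (⟨1, Set.mem_Ioi.2 zero_lt_one⟩ : Set.Ioi (0 : ℝ))).indicator (fun _ => k ω.1) r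
          ∂(volume : Measure (Mom n)).toSphere =
        (Set.Iio (⟨1, Set.mem_Ioi.2 zero_lt_one⟩ : Set.Ioi (0 : ℝ))).indicator
          (fun _ => ∫⁻ ω, k ω.1 ∂(volume : Measure (Mom n)).toSphere) r := fun r => by
      by_cases h : r ∈ Set.Iio (⟨1, Set.mem_Ioi.2 zero_lt_one⟩ : Set.Ioi (0 : ℝ)) <;>
        simp only [Set.indicator, h, if_true, if_false, lintegral_zero]
    simp_rw [this]
    rw [lintegral_indicator_const measurableSet_Iio, Measure.volumeIoiPow_apply_Iio]
    have hn1 : 1 ≤ n := NeZero.one_le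
    simp [Nat.cast_sub hn1]
  have h1 := key h hh
  have h2 := key (fun x => h (σ x)) (by fun_prop)
  have h3 := (measurePreserving_of_norm_map hσ).lintegral_comp
    (f := (Metric.ball 0 1).indicator fun x => h (‖x‖⁻¹ • x))
    (Measurable.indicator (by fun_prop) measurableSet_ball)
  have h4 : ∀ x, (Metric.ball 0 1).indicator (fun x => h (‖x‖⁻¹ • x)) (σ x) =
      (Metric.ball 0 1).indicator (fun x => h (σ (‖x‖⁻¹ • x))) x := fun x => by
    simp only [Set.indicator, mem_ball_zero_iff, hσ, map_smul]
  simp_rw [h4] at h3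
  rw [h1, h2] at h3
  have hn0 : (0 : ℝ) < 1 / n := by have := NeZero.pos n; positivity
  rw [sphereMeasure, lintegral_smul_measure, lintegral_smul_measure,
    (ENNReal.mul_left_inj (ENNReal.ofReal_pos.2 hn0).ne' ENNReal.ofReal_ne_top).1 h3]

/-- The orbit of `d` under a random rotation is uniformly distributed on the sphere of radius `‖d‖`:
its law does not depend on the direction of `d`, hence equals the mean of these laws over all
directions, and this mean is the uniform law, which every rotation preserves. -/
lemma map_rotation_apply [NeZero n] (d : Mom n) :
    (rotationMeasure n).map (fun σ => σ d) = (sphereMeasure n).map fun ω => ‖d‖ • ω.1 := by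
  have hm : ∀ x : Mom n, Measurable fun σ : Mom n →L[ℝ] Mom n => σ x := fun x => by fun_prop
  have hunit : ∀ u : Mom n, ‖u‖ = 1 → ∀ h : Mom n → ℝ≥0∞, Measurable h →
      ∫⁻ σ, h (σ u) ∂rotationMeasure n = ∫⁻ ω, h ω.1 ∂(sphereMeasure n) := by
    intro u hu h hh
    have h1 : ∀ ω : USphere n, ∫⁻ σ, h (σ ω.1) ∂rotationMeasure n =
        ∫⁻ σ, h (σ u) ∂rotationMeasure n := fun ω => by
      rw [← lintegral_map hh (hm _), ← lintegral_map hh (hm _),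
        map_rotation_eq_of_norm_eq_one hu (mem_sphere_zero_iff_norm.1 ω.2)]
    have h2 : ∫⁻ σ, ∫⁻ ω, h (σ ω.1) ∂(sphereMeasure n) ∂rotationMeasure n =
        ∫⁻ ω, h ω.1 ∂(sphereMeasure n) := by
      rw [lintegral_congr_ae ((ae_norm_map_rotation n).mono fun σ hσ =>
        lintegral_sphereMeasure_comp hσ hh), lintegral_const, measure_univ, mul_one]
    have h3 : Measurable fun q : (Mom n →L[ℝ] Mom n) × USphere n => q.1 q.2.1 :=
      ContinuousLinearMap.measurable_apply₂.comp
        (measurable_fst.prodMk (measurable_subtype_coe.comp measurable_snd))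
    rw [← h2, lintegral_lintegral_swap
      (f := fun (σ : Mom n →L[ℝ] Mom n) (ω : USphere n) => h (σ ω.1)) (hh.comp h3).aemeasurable]
    simp_rw [h1]
    rw [lintegral_const, measure_univ, mul_one]
  refine Measure.ext_of_lintegral _ fun h hh => ?_
  rw [lintegral_map hh (hm _), lintegral_map hh (by fun_prop)]
  rcases eq_or_ne d 0 with rfl | hd
  · simp
  · have hd' : ‖d‖ ≠ 0 := norm_ne_zero_iff.2 hd
    rw [← hunit (‖d‖⁻¹ • d) (by rw [norm_smul, norm_inv, norm_norm, inv_mul_cancel₀ hd'])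
      (fun x => h (‖d‖ • x)) (by fun_prop)]
    simp [smul_inv_smul₀ hd']

/-! ### Collision coordinates -/

/-- The parameters `(k, σ)` of the integral: a momentum and a linear map of `ℝⁿ`. -/
abbrev Param (n : ℕ) := Mom n × (Mom n →L[ℝ] Mom n)

/-- Lebesgue measure times the rotation measure, on the parameters `(k, σ)`. -/
abbrev paramMeasure (n : ℕ) : Measure (Param n) :=
  (volume : Measure (Mom n)).prod (rotationMeasure n)

instance : SFinite (paramMeasure n) := Measure.prod.instSFinite

/-- For the heavy momentum `P` and the parameters `(k, σ)`, the displacement momentum `k`, the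
center-of-mass momentum `(1 + λ) (P + σ k)` and the rotation `σ`. -/
def collision (lam : ℝ) (p : Mom n × Param n) : (Mom n × Mom n) × (Mom n →L[ℝ] Mom n) :=
  ((p.2.1, (1 + lam) • (p.1 + p.2.2 p.2.1)), p.2.2)

/-- The heavy and light momenta of displacement momentum `k`, see `ofCM_collision`. -/
def initialPair (lam : ℝ) (p : Mom n × Param n) : Mom n × Mom n :=
  (p.1 - p.2.1 + p.2.2 p.2.1, (1 + lam) • p.2.1 + lam • (p.1 - p.2.1 + p.2.2 p.2.1))

/-- The heavy and light momenta of displacement momentum `σ k`, see `ofCM_rotate_collision`; the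
heavy one is `P`. -/
def finalPair (lam : ℝ) (p : Mom n × Param n) : Mom n × Mom n :=
  (p.1, (1 + lam) • p.2.2 p.2.1 + lam • p.1)

/-- `((d, c), σ) ↦ (σ d, c)` -/
def rotateMap (q : (Mom n × Mom n) × (Mom n →L[ℝ] Mom n)) : Mom n × Mom n :=
  (q.2 q.1.1, q.1.2)

lemma div_smul_smul {lam : ℝ} (hlam : 0 < lam) (x : Mom n) :
    (lam / (1 + lam)) • (1 + lam) • x = lam • x := by
  rw [smul_smul, div_mul_cancel₀ _ (by positivity)]

lemma ofCM_collision {lam : ℝ} (hlam : 0 < lam) (p : Mom n × Param n) :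
    ofCM lam (collision lam p).1 = initialPair lam p := by
  simp only [ofCM, collision, initialPair, div_smul_smul hlam]
  refine Prod.ext ?_ ?_ <;> dsimp only <;> module

lemma ofCM_rotate_collision {lam : ℝ} (hlam : 0 < lam) (p : Mom n × Param n) :
    ofCM lam (rotateMap (collision lam p)) = finalPair lam p := by
  simp only [ofCM, collision, finalPair, rotateMap, div_smul_smul hlam]
  refine Prod.ext ?_ ?_ <;> dsimp only <;> module

lemma measurable_apply_swap :
    Measurable fun p : Param n => p.2 p.1 :=
  ContinuousLinearMap.measurable_apply₂.comp measurable_swap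

lemma measurable_apply_param :
    Measurable fun p : Mom n × Param n => p.2.2 p.2.1 :=
  measurable_apply_swap.comp measurable_snd

lemma measurable_collision (lam : ℝ) : Measurable (collision (n := n) lam) := by
  have := measurable_apply_param (n := n)
  unfold collision
  fun_prop

lemma measurable_initialPair (lam : ℝ) : Measurable (initialPair (n := n) lam) := by
  have := measurable_apply_param (n := n)
  unfold initialPair
  fun_prop

lemma measurable_finalPair (lam : ℝ) : Measurable (finalPair (n := n) lam) := by
  have := measurable_apply_param (n := n)
  unfold finalPair
  fun_prop

lemma measurable_rotateMap : Measurable (rotateMap (n := n)) := by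
  have : Measurable fun q : (Mom n × Mom n) × (Mom n →L[ℝ] Mom n) => q.2 q.1.1 :=
    ContinuousLinearMap.measurable_apply₂.comp
      (measurable_snd.prodMk (measurable_fst.comp measurable_fst))
  unfold rotateMap
  fun_prop

/-- The inverse `(1 + λ)^{-n}` of the Jacobian of the dilation by `1 + λ`. -/
def jac (n : ℕ) (lam : ℝ) : ℝ≥0∞ := ENNReal.ofReal ((1 + lam) ^ n)⁻¹

lemma jac_ne_top (lam : ℝ) : jac n lam ≠ ∞ := ENNReal.ofReal_ne_top

lemma lintegral_comp_affine {lam : ℝ} (hlam : 0 < lam) {h : Mom n → ℝ≥0∞} (hh : Measurable h)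
    (b : Mom n) : ∫⁻ x, h ((1 + lam) • x + b) = jac n lam * ∫⁻ x, h x := by
  have h1 := Measure.map_addHaar_smul (volume : Measure (Mom n)) (r := 1 + lam) (by positivity)
  rw [finrank_euclideanSpace_fin, abs_of_pos (by positivity)] at h1
  rw [← lintegral_map (f := fun y => h (y + b)) (by fun_prop) (by fun_prop), h1,
    lintegral_smul_measure, lintegral_add_right_eq_self h b, jac, smul_eq_mul]

lemma map_collision {lam : ℝ} (hlam : 0 < lam) :
    ((volume : Measure (Mom n)).prod (paramMeasure n)).map (collision lam) =
      jac n lam • (volume : Measure (Mom n × Mom n)).prod (rotationMeasure n) := by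
  refine Measure.ext_of_lintegral _ fun f hf => ?_
  have hfc := hf.comp (measurable_collision (n := n) lam)
  rw [lintegral_map hf (measurable_collision lam), lintegral_smul_measure,
    lintegral_prod_symm (fun p => f (collision lam p)) hfc.aemeasurable,
    lintegral_prod_symm _ hf.aemeasurable,
    lintegral_prod_symm (fun ω : Param n => ∫⁻ P, f (collision lam (P, ω)))
      hfc.lintegral_prod_left'.aemeasurable,
    smul_eq_mul, ← lintegral_const_mul _ hf.lintegral_prod_left']
  refine lintegral_congr fun σ => ?_
  have hfσ : Measurable fun q : Mom n × Mom n => f (q, σ) := by fun_prop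
  rw [Measure.volume_eq_prod, lintegral_prod _ hfσ.aemeasurable,
    ← lintegral_const_mul _ hfσ.lintegral_prod_right']
  refine lintegral_congr fun k => ?_
  rw [← lintegral_comp_affine hlam (h := fun c => f ((k, c), σ)) (by fun_prop)
    ((1 + lam) • σ k)]
  simp only [collision, smul_add]

/-- The mean over rotations is the mean over the sphere. -/
lemma lintegral_rotateMap [NeZero n] {f : Mom n × Mom n → ℝ≥0∞} (hf : Measurable f)
    (p : Mom n × Mom n) :
    ∫⁻ σ, f (rotateMap (p, σ)) ∂rotationMeasure n =
      ∫⁻ ω, f (polarMap n (p, ω)) ∂(sphereMeasure n) := by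
  have hf' : Measurable fun x => f (x, p.2) := by fun_prop
  have h := congrArg (fun ν : Measure (Mom n) => ∫⁻ x, f (x, p.2) ∂ν) (map_rotation_apply p.1)
  rwa [lintegral_map hf' (by fun_prop), lintegral_map hf' (by fun_prop)] at h

lemma measurePreserving_rotateMap [NeZero n] :
    MeasurePreserving (rotateMap (n := n))
      ((volume : Measure (Mom n × Mom n)).prod (rotationMeasure n)) volume := by
  refine ⟨measurable_rotateMap, Measure.ext_of_lintegral _ fun f hf => ?_⟩
  rw [lintegral_map hf measurable_rotateMap,
    lintegral_prod (fun q => f (rotateMap q)) (hf.comp measurable_rotateMap).aemeasurable,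
    ← measurePreserving_polarMap.lintegral_comp hf,
    lintegral_prod (fun q => f (polarMap n q))
      (hf.comp measurePreserving_polarMap.measurable).aemeasurable]
  exact lintegral_congr fun p => lintegral_rotateMap hf p

lemma measurePreserving_collision {lam : ℝ} (hlam : 0 < lam) :
    MeasurePreserving (collision (n := n) lam) ((volume : Measure (Mom n)).prod (paramMeasure n))
      (jac n lam • (volume : Measure (Mom n × Mom n)).prod (rotationMeasure n)) :=
  ⟨measurable_collision lam, map_collision hlam⟩

lemma measurePreserving_initialPair {lam : ℝ} (hlam : 0 < lam) :
    MeasurePreserving (initialPair (n := n) lam)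
      ((volume : Measure (Mom n)).prod (paramMeasure n)) (jac n lam • volume) := by
  have h := (measurePreserving_ofCM (n := n) lam).comp
    (measurePreserving_fst (μ := (volume : Measure (Mom n × Mom n))) (ν := rotationMeasure n))
  have h' := (h.smul_measure (jac n lam)).comp (measurePreserving_collision hlam)
  exact (funext (ofCM_collision hlam) : _ = initialPair lam) ▸ h'

lemma measurePreserving_finalPair [NeZero n] {lam : ℝ} (hlam : 0 < lam) :
    MeasurePreserving (finalPair (n := n) lam)
      ((volume : Measure (Mom n)).prod (paramMeasure n)) (jac n lam • volume) := by
  have h := (measurePreserving_ofCM (n := n) lam).comp measurePreserving_rotateMap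
  have h' := (h.smul_measure (jac n lam)).comp (measurePreserving_collision hlam)
  exact (funext (ofCM_rotate_collision hlam) : _ = finalPair lam) ▸ h'

lemma ae_initialPair {lam : ℝ} (hlam : 0 < lam) {p : Mom n × Mom n → Prop} (hp : ∀ᵐ x, p x) :
    ∀ᵐ q ∂(volume : Measure (Mom n)).prod (paramMeasure n), p (initialPair lam q) :=
  (measurePreserving_initialPair hlam).quasiMeasurePreserving.ae (Measure.ae_smul_measure hp _)

lemma ae_finalPair [NeZero n] {lam : ℝ} (hlam : 0 < lam) {p : Mom n × Mom n → Prop}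
    (hp : ∀ᵐ x, p x) :
    ∀ᵐ q ∂(volume : Measure (Mom n)).prod (paramMeasure n), p (finalPair lam q) :=
  (measurePreserving_finalPair hlam).quasiMeasurePreserving.ae (Measure.ae_smul_measure hp _)

lemma lintegral_finalPair_snd {lam : ℝ} (hlam : 0 < lam) {h : Mom n → ℝ≥0∞} (hh : Measurable h)
    (P : Mom n) :
    ∫⁻ ω, h (finalPair lam (P, ω)).2 ∂paramMeasure n = jac n lam * ∫⁻ x, h x := by
  have hm : Measurable fun ω : Param n => h (finalPair lam (P, ω)).2 :=
    hh.comp (measurable_snd.comp ((measurable_finalPair lam).comp measurable_prodMk_left))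
  rw [lintegral_prod_symm _ hm.aemeasurable]
  have : ∀ᵐ σ ∂rotationMeasure n,
      ∫⁻ k, h (finalPair lam (P, (k, σ))).2 = jac n lam * ∫⁻ x, h x := by
    filter_upwards [ae_norm_map_rotation n] with σ hσ
    rw [← lintegral_comp_affine hlam hh (lam • P)]
    exact (measurePreserving_of_norm_map hσ).lintegral_comp
      (f := fun x => h ((1 + lam) • x + lam • P)) (by fun_prop)
  rw [lintegral_congr_ae this, lintegral_const, measure_univ, mul_one]

lemma integrand_apply (r : Mom n → Mom n → ℂ) (a lam : ℝ) (ω : Param n) (f : Mom n → ℂ)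
    (P : Mom n) :
    integrand r a lam ω f P = r (initialPair lam (P, ω)).2 (finalPair lam (P, ω)).2 *
      ((starRingEnd ℂ) (scatteringCoeff n a lam ‖ω.1‖) * f (initialPair lam (P, ω)).1) := by
  have h1 : ω.2 ω.1 + lam • ω.1 + lam • (P - ω.1 + ω.2 ω.1) =
      (1 + lam) • ω.2 ω.1 + lam • P := by module
  simp only [integrand, translation, multiplierP, initialPair, finalPair, sub_neg_eq_add, h1]

/-! ### The integral as a bounded operator -/

/-- `|r(x, y)|² ≤ φ(x) γ(y)` at almost all pairs of light momenta that occur in the integral, with `φ`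
and `γ` integrable. -/
structure KernelBound (r : Mom n → Mom n → ℂ) (lam : ℝ) (φ γ : Mom n → ℝ≥0∞) : Prop where
  measurable_left : Measurable φ
  measurable_right : Measurable γ
  lintegral_left : ∫⁻ x, φ x ≠ ∞
  lintegral_right : ∫⁻ x, γ x ≠ ∞
  bound : ∀ᵐ q ∂(volume : Measure (Mom n)).prod (paramMeasure n),
    ‖r (initialPair lam q).2 (finalPair lam q).2‖ₑ ^ 2 ≤
      φ (initialPair lam q).2 * γ (finalPair lam q).2

/-- The density `φ(x) |ψ(K')|²` at the initial light momentum `x` and heavy momentum `K'`. -/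
def initialDensity (lam : ℝ) (φ : Mom n → ℝ≥0∞) (ψ : Mom n → ℂ) (q : Mom n × Param n) : ℝ≥0∞ :=
  ‖ψ (initialPair lam q).1‖ₑ ^ 2 * φ (initialPair lam q).2

lemma measurable_initialDensity (lam : ℝ) {φ : Mom n → ℝ≥0∞} (hφ : Measurable φ) (ψ : L2 n) :
    Measurable (initialDensity lam φ ψ) := by
  have hψ := (Lp.stronglyMeasurable ψ).measurable
  have := measurable_initialPair (n := n) lam
  unfold initialDensity
  fun_prop

lemma lintegral_initialDensity {lam : ℝ} (hlam : 0 < lam) {φ : Mom n → ℝ≥0∞} (hφ : Measurable φ)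
    (ψ : L2 n) :
    ∫⁻ q, initialDensity lam φ ψ q ∂(volume : Measure (Mom n)).prod (paramMeasure n) =
      jac n lam * (∫⁻ x, φ x) * ‖ψ‖ₑ ^ 2 := by
  have hψ := (Lp.stronglyMeasurable ψ).measurable
  have h := (measurePreserving_initialPair (n := n) hlam).lintegral_comp
    (f := fun p => ‖ψ p.1‖ₑ ^ 2 * φ p.2) (by fun_prop)
  refine h.trans ?_
  rw [lintegral_smul_measure, Measure.volume_eq_prod,
    lintegral_prod_mul (f := fun x => ‖ψ x‖ₑ ^ 2) (by fun_prop) hφ.aemeasurable,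
    lintegral_enorm_sq, smul_eq_mul, mul_assoc, mul_comm (‖ψ‖ₑ ^ 2)]

lemma measurable_integrand {r : Mom n → Mom n → ℂ} (hr : Continuous (Function.uncurry r))
    (a lam : ℝ) (ψ : L2 n) :
    Measurable fun q : Mom n × Param n => integrand r a lam q.2 ψ q.1 := by
  have hψ := (Lp.stronglyMeasurable ψ).measurable
  have h1 := measurable_initialPair (n := n) lam
  have h2 := measurable_finalPair (n := n) lam
  have h3 : Measurable fun q : Mom n × Param n =>
      r (initialPair lam q).2 (finalPair lam q).2 :=
    hr.measurable.comp (h1.snd.prodMk h2.snd)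
  have h4 := (measurable_scatteringCoeff n a lam)
  have h5 : Measurable fun q : Mom n × Param n =>
      (starRingEnd ℂ) (scatteringCoeff n a lam ‖q.2.1‖) :=
    Complex.continuous_conj.measurable.comp (h4.comp (by fun_prop))
  simp only [integrand_apply]
  fun_prop

/-- Cauchy–Schwarz for functions whose square is dominated by a product. -/
lemma lintegral_sq_le_mul {α : Type*} [MeasurableSpace α] {μ : Measure α} {h f g : α → ℝ≥0∞}
    (hf : AEMeasurable f μ) (hg : AEMeasurable g μ) (hle : ∀ᵐ x ∂μ, h x ^ 2 ≤ f x * g x) :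
    (∫⁻ x, h x ∂μ) ^ 2 ≤ (∫⁻ x, f x ∂μ) * ∫⁻ x, g x ∂μ := by
  have hhalf : ∀ b c : ℝ≥0∞, (b ^ (1 / 2 : ℝ) * c ^ (1 / 2 : ℝ)) ^ 2 = b * c := fun b c => by
    rw [mul_pow, ← ENNReal.rpow_natCast, ← ENNReal.rpow_natCast, ← ENNReal.rpow_mul,
      ← ENNReal.rpow_mul]
    norm_num
  rw [← hhalf]
  gcongr
  refine le_trans (lintegral_mono_ae ?_)
    (ENNReal.lintegral_mul_norm_pow_le hf hg (by norm_num) (by norm_num) (by norm_num))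
  filter_upwards [hle] with x hx
  rw [← hhalf] at hx
  exact (ENNReal.pow_le_pow_left_iff two_ne_zero).1 hx

lemma enorm_integrand_sq_le {r : Mom n → Mom n → ℂ} (a lam : ℝ) {φ γ : Mom n → ℝ≥0∞}
    (ψ : Mom n → ℂ) {q : Mom n × Param n}
    (h : ‖r (initialPair lam q).2 (finalPair lam q).2‖ₑ ^ 2 ≤
      φ (initialPair lam q).2 * γ (finalPair lam q).2) :
    ‖integrand r a lam q.2 ψ q.1‖ₑ ^ 2 ≤
      (4 * γ (finalPair lam q).2) * initialDensity lam φ ψ q := by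
  have hS : ‖scatteringCoeff n a lam ‖q.2.1‖‖ₑ ^ 2 ≤ 4 := by
    have h2 : ‖scatteringCoeff n a lam ‖q.2.1‖‖ₑ ≤ 2 := by
      rw [← ofReal_norm]
      exact ENNReal.ofReal_le_of_le_toReal (norm_scatteringCoeff_le _ _ _ _)
    exact (pow_le_pow_left₀ zero_le h2 2).trans (by norm_num)
  have hc : ∀ z : ℂ, ‖(starRingEnd ℂ) z‖ₑ = ‖z‖ₑ := fun z => by
    rw [← ofReal_norm, RCLike.norm_conj, ofReal_norm]
  rw [integrand_apply, enorm_mul, enorm_mul, mul_pow, mul_pow, hc, initialDensity]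
  calc _ ≤ (φ (initialPair lam q).2 * γ (finalPair lam q).2) *
        (4 * ‖ψ (initialPair lam q).1‖ₑ ^ 2) := by gcongr
    _ = _ := by ring

lemma lintegral_integrand_sq_le {r : Mom n → Mom n → ℂ} (a : ℝ) {lam : ℝ} (hlam : 0 < lam)
    {φ γ : Mom n → ℝ≥0∞} (hb : KernelBound r lam φ γ) (ψ : L2 n) :
    ∀ᵐ P, ∀ E : Set (Param n),
      (∫⁻ ω in E, ‖integrand r a lam ω ψ P‖ₑ ∂paramMeasure n) ^ 2 ≤
        (4 * (jac n lam * ∫⁻ x, γ x)) *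
          ∫⁻ ω in E, initialDensity lam φ ψ (P, ω) ∂paramMeasure n := by
  filter_upwards [Measure.ae_ae_of_ae_prod hb.bound] with P hP E
  have hm : Measurable fun ω : Param n => γ (finalPair lam (P, ω)).2 :=
    hb.measurable_right.comp
      (measurable_snd.comp ((measurable_finalPair lam).comp measurable_prodMk_left))
  have hm' : Measurable fun ω : Param n => initialDensity lam φ ψ (P, ω) :=
    (measurable_initialDensity lam hb.measurable_left ψ).comp measurable_prodMk_left
  refine (lintegral_sq_le_mul (hm.const_mul 4).aemeasurable hm'.aemeasurable
    (ae_restrict_of_ae (hP.mono fun ω hω => enorm_integrand_sq_le a lam ψ hω))).trans ?_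
  gcongr
  refine (lintegral_mono' Measure.restrict_le_self le_rfl).trans ?_
  rw [lintegral_const_mul _ hm, lintegral_finalPair_snd hlam hb.measurable_right]

/-- The integral of the operator-valued integrand over a set `E` of parameters, applied to `f`. -/
def partialIntegral (r : Mom n → Mom n → ℂ) (a lam : ℝ) (E : Set (Param n)) (f : Mom n → ℂ)
    (P : Mom n) : ℂ :=
  ∫ ω in E, integrand r a lam ω f P ∂paramMeasure n

/-- The total mass of `initialDensity` over a set of parameters. -/
def initialMass (lam : ℝ) (φ : Mom n → ℝ≥0∞) (E : Set (Param n)) (ψ : Mom n → ℂ) : ℝ≥0∞ :=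
  ∫⁻ P, ∫⁻ ω in E, initialDensity lam φ ψ (P, ω) ∂paramMeasure n

lemma initialMass_le {lam : ℝ} (hlam : 0 < lam) {φ : Mom n → ℝ≥0∞} (hφ : Measurable φ)
    (E : Set (Param n)) (ψ : L2 n) :
    initialMass lam φ E ψ ≤ jac n lam * (∫⁻ x, φ x) * ‖ψ‖ₑ ^ 2 := by
  rw [← lintegral_initialDensity hlam hφ ψ,
    lintegral_prod _ (measurable_initialDensity lam hφ ψ).aemeasurable]
  exact lintegral_mono fun P => lintegral_mono' Measure.restrict_le_self le_rfl

lemma measurable_lintegral_initialDensity (lam : ℝ) {φ : Mom n → ℝ≥0∞} (hφ : Measurable φ)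
    (E : Set (Param n)) (ψ : L2 n) :
    Measurable fun P => ∫⁻ ω in E, initialDensity lam φ ψ (P, ω) ∂paramMeasure n :=
  (measurable_initialDensity lam hφ ψ).lintegral_prod_right'

/-- The constant `4 (1 + λ)^{-n} ∫ γ` in the bound for partial integrals. -/
def boundConst (lam : ℝ) (γ : Mom n → ℝ≥0∞) : ℝ≥0∞ := 4 * (jac n lam * ∫⁻ x, γ x)

section PartialIntegral

variable {r : Mom n → Mom n → ℂ} {a lam : ℝ} {φ γ : Mom n → ℝ≥0∞}

lemma KernelBound.boundConst_ne_top (hb : KernelBound r lam φ γ) : boundConst lam γ ≠ ∞ :=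
  ENNReal.mul_ne_top (by simp) (ENNReal.mul_ne_top (jac_ne_top lam) hb.lintegral_right)

lemma KernelBound.mul_jac_ne_top (hb : KernelBound r lam φ γ) :
    boundConst lam γ * (jac n lam * ∫⁻ x, φ x) ≠ ∞ :=
  ENNReal.mul_ne_top hb.boundConst_ne_top
    (ENNReal.mul_ne_top (jac_ne_top lam) hb.lintegral_left)

lemma KernelBound.mul_initialMass_lt_top (hb : KernelBound r lam φ γ) (hlam : 0 < lam)
    (E : Set (Param n)) (ψ : L2 n) : boundConst lam γ * initialMass lam φ E ψ < ∞ := by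
  refine lt_of_le_of_lt (mul_le_mul_right (initialMass_le hlam hb.measurable_left E ψ) _) ?_
  rw [← mul_assoc]
  exact (ENNReal.mul_ne_top hb.mul_jac_ne_top (by simp)).lt_top

lemma KernelBound.integrableOn_integrand (hb : KernelBound r lam φ γ) (hlam : 0 < lam)
    (hr : Continuous (Function.uncurry r)) (a : ℝ) (E : Set (Param n)) (ψ : L2 n) :
    ∀ᵐ P, IntegrableOn (fun ω => integrand r a lam ω ψ P) E (paramMeasure n) := by
  have hmeas := measurable_lintegral_initialDensity lam hb.measurable_left E ψ
  have hfin : ∀ᵐ P, boundConst lam γ *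
      ∫⁻ ω in E, initialDensity lam φ ψ (P, ω) ∂paramMeasure n < ∞ := by
    refine ae_lt_top (hmeas.const_mul _) ?_
    rw [lintegral_const_mul _ hmeas]
    exact (hb.mul_initialMass_lt_top hlam E ψ).ne
  filter_upwards [lintegral_integrand_sq_le a hlam hb ψ, hfin] with P h1 h2
  refine ⟨((measurable_integrand hr a lam ψ).comp measurable_prodMk_left).aestronglyMeasurable, ?_⟩
  exact (ENNReal.pow_lt_top_iff.1 ((h1 E).trans_lt h2)).resolve_right two_ne_zero

lemma KernelBound.eLpNorm_partialIntegral_sq_le (hb : KernelBound r lam φ γ) (hlam : 0 < lam)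
    (a : ℝ) (E : Set (Param n)) (ψ : L2 n) :
    eLpNorm (partialIntegral r a lam E ψ) 2 volume ^ 2 ≤
      boundConst lam γ * initialMass lam φ E ψ := by
  have h2 : eLpNorm (partialIntegral r a lam E ψ) 2 volume ^ 2 =
      ∫⁻ P, ‖partialIntegral r a lam E ψ P‖ₑ ^ 2 := by
    rw [eLpNorm_eq_lintegral_rpow_enorm_toReal two_ne_zero ENNReal.ofNat_ne_top,
      ← ENNReal.rpow_natCast, ← ENNReal.rpow_mul]
    simp
  rw [h2, initialMass,
    ← lintegral_const_mul _ (measurable_lintegral_initialDensity lam hb.measurable_left E ψ)]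
  refine lintegral_mono_ae ?_
  filter_upwards [lintegral_integrand_sq_le a hlam hb ψ] with P h1
  refine le_trans ?_ (h1 E)
  gcongr
  exact enorm_integral_le_lintegral_enorm _

lemma KernelBound.memLp_partialIntegral (hb : KernelBound r lam φ γ) (hlam : 0 < lam)
    (hr : Continuous (Function.uncurry r)) (a : ℝ) (E : Set (Param n)) (ψ : L2 n) :
    MemLp (partialIntegral r a lam E ψ) 2 volume :=
  ⟨((measurable_integrand hr a lam ψ).stronglyMeasurable.integral_prod_right'
      (ν := (paramMeasure n).restrict E)).aestronglyMeasurable,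
    (ENNReal.pow_lt_top_iff.1 ((hb.eLpNorm_partialIntegral_sq_le hlam a E ψ).trans_lt
      (hb.mul_initialMass_lt_top hlam E ψ))).resolve_right two_ne_zero⟩

lemma partialIntegral_congr (hlam : 0 < lam) (E : Set (Param n)) {f g : Mom n → ℂ}
    (hfg : f =ᵐ[volume] g) :
    partialIntegral r a lam E f =ᵐ[volume] partialIntegral r a lam E g := by
  filter_upwards [Measure.ae_ae_of_ae_prod (ae_initialPair hlam (ae_fst hfg))] with P hP
  refine integral_congr_ae (ae_restrict_of_ae ?_)
  filter_upwards [hP] with ω hω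
  simp only [integrand_apply, hω]

lemma partialIntegral_add {E : Set (Param n)} {f g : Mom n → ℂ} {P : Mom n}
    (hf : IntegrableOn (fun ω => integrand r a lam ω f P) E (paramMeasure n))
    (hg : IntegrableOn (fun ω => integrand r a lam ω g P) E (paramMeasure n)) :
    partialIntegral r a lam E (f + g) P =
      partialIntegral r a lam E f P + partialIntegral r a lam E g P := by
  rw [partialIntegral, partialIntegral, partialIntegral, ← integral_add hf hg]
  simp only [integrand_apply, Pi.add_apply, mul_add]

lemma partialIntegral_smul (E : Set (Param n)) (c : ℂ) (f : Mom n → ℂ) (P : Mom n) :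
    partialIntegral r a lam E (c • f) P = c • partialIntegral r a lam E f P := by
  rw [partialIntegral, partialIntegral, ← integral_smul]
  congr 1
  funext ω
  simp only [integrand_apply, Pi.smul_apply, smul_eq_mul]
  ring

/-- The partial integral over a set of parameters as a linear map of `L²`. -/
def KernelBound.partialLinear (hb : KernelBound r lam φ γ) (hlam : 0 < lam)
    (hr : Continuous (Function.uncurry r)) (a : ℝ) (E : Set (Param n)) : L2 n →ₗ[ℂ] L2 n where
  toFun ψ := (hb.memLp_partialIntegral hlam hr a E ψ).toLp _
  map_add' f g := by
    apply Lp.ext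
    filter_upwards [(hb.memLp_partialIntegral hlam hr a E (f + g)).coeFn_toLp,
      (hb.memLp_partialIntegral hlam hr a E f).coeFn_toLp,
      (hb.memLp_partialIntegral hlam hr a E g).coeFn_toLp,
      Lp.coeFn_add ((hb.memLp_partialIntegral hlam hr a E f).toLp _)
        ((hb.memLp_partialIntegral hlam hr a E g).toLp _),
      partialIntegral_congr (r := r) (a := a) hlam E (Lp.coeFn_add f g),
      hb.integrableOn_integrand hlam hr a E f, hb.integrableOn_integrand hlam hr a E g]
      with P h1 h2 h3 h4 h5 h6 h7
    rw [h1, h4, Pi.add_apply, h2, h3, h5, partialIntegral_add h6 h7]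
  map_smul' c f := by
    apply Lp.ext
    filter_upwards [(hb.memLp_partialIntegral hlam hr a E (c • f)).coeFn_toLp,
      (hb.memLp_partialIntegral hlam hr a E f).coeFn_toLp,
      Lp.coeFn_smul c ((hb.memLp_partialIntegral hlam hr a E f).toLp _),
      partialIntegral_congr (r := r) (a := a) hlam E (Lp.coeFn_smul c f)] with P h1 h2 h3 h4
    rw [RingHom.id_apply, h1, h3, Pi.smul_apply, h2, h4, partialIntegral_smul]

lemma KernelBound.enorm_partialLinear_sq_le (hb : KernelBound r lam φ γ) (hlam : 0 < lam)
    (hr : Continuous (Function.uncurry r)) (a : ℝ) (E : Set (Param n)) (ψ : L2 n) :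
    ‖hb.partialLinear hlam hr a E ψ‖ₑ ^ 2 ≤ boundConst lam γ * initialMass lam φ E ψ :=
  (congrArg (· ^ 2) (Lp.enorm_toLp (hb.memLp_partialIntegral hlam hr a E ψ))).le.trans
    (hb.eLpNorm_partialIntegral_sq_le hlam a E ψ)

lemma KernelBound.norm_partialLinear_le (hb : KernelBound r lam φ γ) (hlam : 0 < lam)
    (hr : Continuous (Function.uncurry r)) (a : ℝ) (E : Set (Param n)) (ψ : L2 n) :
    ‖hb.partialLinear hlam hr a E ψ‖ ≤
      Real.sqrt (boundConst lam γ * (jac n lam * ∫⁻ x, φ x)).toReal * ‖ψ‖ := by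
  have h1 : ‖hb.partialLinear hlam hr a E ψ‖ₑ ^ 2 ≤
      boundConst lam γ * (jac n lam * ∫⁻ x, φ x) * ‖ψ‖ₑ ^ 2 := by
    rw [mul_assoc]
    exact (hb.enorm_partialLinear_sq_le hlam hr a E ψ).trans
      (mul_le_mul_right (initialMass_le hlam hb.measurable_left E ψ) _)
  have h2 := ENNReal.toReal_mono (ENNReal.mul_ne_top hb.mul_jac_ne_top (by simp)) h1
  rw [ENNReal.toReal_pow, ENNReal.toReal_mul, ENNReal.toReal_pow, toReal_enorm, toReal_enorm] at h2
  refine (abs_le_of_sq_le_sq' ?_ (by positivity)).2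
  rwa [mul_pow, Real.sq_sqrt ENNReal.toReal_nonneg]

/-- The partial integral over a set of parameters as a bounded operator. -/
def KernelBound.partialOp (hb : KernelBound r lam φ γ) (hlam : 0 < lam)
    (hr : Continuous (Function.uncurry r)) (a : ℝ) (E : Set (Param n)) : L2 n →L[ℂ] L2 n :=
  (hb.partialLinear hlam hr a E).mkContinuous _ (hb.norm_partialLinear_le hlam hr a E)

lemma KernelBound.coeFn_partialOp (hb : KernelBound r lam φ γ) (hlam : 0 < lam)
    (hr : Continuous (Function.uncurry r)) (a : ℝ) (E : Set (Param n)) (ψ : L2 n) :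
    hb.partialOp hlam hr a E ψ =ᵐ[volume] partialIntegral r a lam E ψ :=
  (hb.memLp_partialIntegral hlam hr a E ψ).coeFn_toLp

lemma KernelBound.partialOp_univ_sub (hb : KernelBound r lam φ γ) (hlam : 0 < lam)
    (hr : Continuous (Function.uncurry r)) (a : ℝ) {E : Set (Param n)} (hE : MeasurableSet E)
    (ψ : L2 n) :
    hb.partialOp hlam hr a Set.univ ψ - hb.partialOp hlam hr a E ψ =
      hb.partialOp hlam hr a Eᶜ ψ := by
  apply Lp.ext
  filter_upwards [hb.coeFn_partialOp hlam hr a Set.univ ψ, hb.coeFn_partialOp hlam hr a E ψ,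
    hb.coeFn_partialOp hlam hr a Eᶜ ψ, Lp.coeFn_sub (hb.partialOp hlam hr a Set.univ ψ)
    (hb.partialOp hlam hr a E ψ), hb.integrableOn_integrand hlam hr a Set.univ ψ]
    with P h1 h2 h3 h4 h5
  rw [h4, Pi.sub_apply, h1, h2, h3, partialIntegral, partialIntegral, partialIntegral,
    Measure.restrict_univ, sub_eq_iff_eq_add']
  exact (integral_add_compl hE (integrableOn_univ.1 h5)).symm

/-- The mass of the complements of an exhaustion tends to zero. -/
lemma tendsto_initialMass_compl (hlam : 0 < lam) (hφ : Measurable φ) (hφ' : ∫⁻ x, φ x ≠ ∞)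
    {E : ℕ → Set (Param n)} (hE : ∀ N, MeasurableSet (E N)) (hmono : Monotone E)
    (hun : ⋃ N, E N = Set.univ) (ψ : L2 n) :
    Tendsto (fun N => initialMass lam φ (E N)ᶜ ψ) atTop (𝓝 0) := by
  have hQ := measurable_initialDensity lam hφ ψ
  have h1 : ∀ N, initialMass lam φ (E N)ᶜ ψ =
      ∫⁻ q, (Prod.snd ⁻¹' (E N)ᶜ).indicator (initialDensity lam φ ψ) q
        ∂(volume : Measure (Mom n)).prod (paramMeasure n) := fun N => by
    rw [lintegral_prod _ (hQ.indicator (measurable_snd (hE N).compl)).aemeasurable]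
    refine lintegral_congr fun P => ?_
    rw [← lintegral_indicator (hE N).compl]
    rfl
  simp_rw [h1]
  rw [← lintegral_zero (μ := (volume : Measure (Mom n)).prod (paramMeasure n))]
  refine tendsto_lintegral_of_dominated_convergence (initialDensity lam φ ψ)
    (fun N => hQ.indicator (measurable_snd (hE N).compl))
    (fun N => Eventually.of_forall fun q => Set.indicator_le_self _ _ q) ?_
    (Eventually.of_forall fun q => ?_)
  · rw [lintegral_initialDensity hlam hφ]
    exact ENNReal.mul_ne_top (ENNReal.mul_ne_top (jac_ne_top lam) hφ') (by simp)
  · obtain ⟨N, hN⟩ := Set.mem_iUnion.1 (hun.symm ▸ Set.mem_univ q.2 : q.2 ∈ ⋃ N, E N)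
    refine tendsto_const_nhds.congr' ?_
    filter_upwards [eventually_ge_atTop N] with M hM
    exact (Set.indicator_of_notMem (not_not.2 (hmono hM hN) :
      q ∉ Prod.snd ⁻¹' (E M)ᶜ) _).symm

/-- The integral over all parameters converges strongly: the part over `E`, applied to `ψ`, has its
norm controlled by the mass `initialMass` of `E`. -/
lemma KernelBound.isStrongIntegral (hb : KernelBound r lam φ γ) (hlam : 0 < lam)
    (hr : Continuous (Function.uncurry r)) (a : ℝ) :
    IsStrongIntegral (paramMeasure n) (integrand r a lam) (hb.partialOp hlam hr a Set.univ) := by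
  refine ⟨hb.partialOp hlam hr a, fun E _ ψ => ?_, fun E hE hmono hun ψ => ?_⟩
  · filter_upwards [hb.integrableOn_integrand hlam hr a E ψ, hb.coeFn_partialOp hlam hr a E ψ]
      with P h1 h2
    exact ⟨h1, h2⟩
  · have h0 := ENNReal.Tendsto.const_mul (a := boundConst lam γ)
      (tendsto_initialMass_compl hlam hb.measurable_left hb.lintegral_left hE hmono hun ψ)
      (Or.inr hb.boundConst_ne_top)
    rw [mul_zero] at h0
    have h1 : Tendsto (fun N => ‖hb.partialOp hlam hr a Set.univ ψ -
        hb.partialOp hlam hr a (E N) ψ‖ₑ ^ 2) atTop (𝓝 0) := by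
      refine tendsto_of_tendsto_of_tendsto_of_le_of_le tendsto_const_nhds h0
        (fun _ => zero_le) fun N => ?_
      simp only [hb.partialOp_univ_sub hlam hr a (hE N) ψ]
      exact hb.enorm_partialLinear_sq_le hlam hr a (E N)ᶜ ψ
    have h2 := (ENNReal.tendsto_toReal ENNReal.zero_ne_top).comp h1
    simp only [Function.comp_def, ENNReal.toReal_pow, toReal_enorm, ENNReal.toReal_zero] at h2
    have h3 := (Real.continuous_sqrt.tendsto 0).comp h2
    simp only [Function.comp_def, Real.sqrt_sq (norm_nonneg _), Real.sqrt_zero] at h3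
    rw [tendsto_iff_norm_sub_tendsto_zero]
    simpa only [norm_sub_rev] using h3

end PartialIntegral

/-! ### Expansion of the density operator and the sesquilinear form of `A` -/

/-- Two vectors can be rescaled inversely to have the same norm, unless one of them vanishes. -/
lemma exists_rescale {E : Type*} [NormedAddCommGroup E] [NormedSpace ℂ E] (f g : E) :
    ∃ s t : ℝ, ‖(s : ℂ) • f‖ ^ 2 = ‖f‖ * ‖g‖ ∧ ‖(t : ℂ) • g‖ ^ 2 = ‖f‖ * ‖g‖ ∧
      (s * t = 1 ∨ f = 0 ∨ g = 0) := by
  have hnorm : ∀ x y : E, ‖((Real.sqrt (‖y‖ / ‖x‖) : ℝ) : ℂ) • x‖ ^ 2 = ‖x‖ * ‖y‖ := fun x y => by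
    rw [norm_smul, Complex.norm_real, Real.norm_of_nonneg (Real.sqrt_nonneg _), mul_pow,
      Real.sq_sqrt (by positivity)]
    rcases eq_or_ne ‖x‖ 0 with h | h
    · simp [h]
    · field_simp
  refine ⟨Real.sqrt (‖g‖ / ‖f‖), Real.sqrt (‖f‖ / ‖g‖), hnorm f g,
    (hnorm g f).trans (mul_comm _ _), ?_⟩
  by_cases h1 : f = 0
  · exact Or.inr (Or.inl h1)
  by_cases h2 : g = 0
  · exact Or.inr (Or.inr h2)
  left
  have h1' := norm_ne_zero_iff.2 h1
  have h2' := norm_ne_zero_iff.2 h2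
  rw [← Real.sqrt_mul (by positivity), div_mul_div_comm, mul_comm ‖f‖, div_self (by positivity),
    Real.sqrt_one]

lemma hasSum_idTensor {ρ : L2 n →L[ℂ] L2 n} (hρ : IsTraceClass ρ) :
    HasSum (fun j => tensorRight (hρ.choose j) ∘L
      ContinuousLinearMap.adjoint (tensorRight (hρ.choose_spec.choose j))) (idTensor hρ) := by
  refine Summable.hasSum (Summable.of_norm_bounded hρ.choose_spec.choose_spec.1 fun j => ?_)
  refine (ContinuousLinearMap.opNorm_comp_le _ _).trans ?_
  rw [LinearIsometryEquiv.norm_map]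
  exact mul_le_mul (norm_tensorRight_le _) (norm_tensorRight_le _) (norm_nonneg _)
    (norm_nonneg _)

lemma adjoint_tensorRight_smul (t : ℝ) (g : L2 n) (x : L2Pair n) :
    ContinuousLinearMap.adjoint (tensorRight ((t : ℂ) • g)) x =
      (t : ℂ) • ContinuousLinearMap.adjoint (tensorRight g) x := by
  refine ext_inner_left ℂ fun w => ?_
  rw [ContinuousLinearMap.adjoint_inner_right, tensorRight_apply, inner_smul_right,
    ContinuousLinearMap.adjoint_inner_right, tensorRight_apply, tensor_smul_right, inner_smul_left,
    Complex.conj_ofReal]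

lemma tensorRight_comp_adjoint_rescale {f g : L2 n} {s t : ℝ} (h : s * t = 1 ∨ f = 0 ∨ g = 0) :
    tensorRight ((s : ℂ) • f) ∘L ContinuousLinearMap.adjoint (tensorRight ((t : ℂ) • g)) =
      tensorRight f ∘L ContinuousLinearMap.adjoint (tensorRight g) := by
  have hT0 : ∀ w : L2 n, tensor w (0 : L2 n) = 0 := fun w => by
    simpa using tensor_smul_right 0 w (0 : L2 n)
  have hT0' : ∀ u : L2 n, tensor (0 : L2 n) u = 0 := fun u => (tensorRight u).map_zero
  refine ContinuousLinearMap.ext fun x => ?_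
  change tensor (ContinuousLinearMap.adjoint (tensorRight ((t : ℂ) • g)) x) ((s : ℂ) • f) =
    tensor (ContinuousLinearMap.adjoint (tensorRight g) x) f
  have hadj := adjoint_tensorRight_smul t g x
  have hadj0 : g = 0 → ContinuousLinearMap.adjoint (tensorRight g) x = 0 := fun hg => by
    simpa [hg] using adjoint_tensorRight_smul 0 (0 : L2 n) x
  rw [hadj]
  generalize ContinuousLinearMap.adjoint (tensorRight g) x = y at hadj0
  rw [tensor_smul_right (s : ℂ) ((t : ℂ) • y) f, tensor_smul (t : ℂ) y f]
  rcases h with h | rfl | h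
  · have hst : (s : ℂ) * t = 1 := by exact_mod_cast h
    rw [← mul_smul, hst, one_smul]
  · rw [hT0, smul_zero, smul_zero]
  · rw [hadj0 h, hT0', smul_zero, smul_zero]

lemma inner_smul_rescale {f g : L2 n} {s t : ℝ} (h : s * t = 1 ∨ f = 0 ∨ g = 0) (ψ : L2 n) :
    inner ℂ ((t : ℂ) • g) ψ • (s : ℂ) • f = inner ℂ g ψ • f := by
  rcases h with h | rfl | rfl
  · rw [inner_smul_left, Complex.conj_ofReal, smul_smul, mul_right_comm, ← Complex.ofReal_mul,
      mul_comm t, h, Complex.ofReal_one, one_mul]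
  · simp
  · simp

/-- A trace class operator is `∑ⱼ |fⱼ⟩⟨gⱼ|` with square summable norms on both sides. -/
lemma IsTraceClass.exists_expansion {ρ : L2 n →L[ℂ] L2 n} (hρ : IsTraceClass ρ) :
    ∃ f g : ℕ → L2 n, Summable (fun j => ‖f j‖ ^ 2) ∧ Summable (fun j => ‖g j‖ ^ 2) ∧
      (∀ ψ, HasSum (fun j => inner ℂ (g j) ψ • f j) (ρ ψ)) ∧
      HasSum (fun j => tensorRight (f j) ∘L ContinuousLinearMap.adjoint (tensorRight (g j)))
        (idTensor hρ) := by
  choose s t hs ht hst using fun j => exists_rescale (hρ.choose j) (hρ.choose_spec.choose j)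
  refine ⟨fun j => (s j : ℂ) • hρ.choose j, fun j => (t j : ℂ) • hρ.choose_spec.choose j,
    ?_, ?_, fun ψ => ?_, ?_⟩
  · simpa only [hs] using hρ.choose_spec.choose_spec.1
  · simpa only [ht] using hρ.choose_spec.choose_spec.1
  · simpa only [inner_smul_rescale (hst _)] using hρ.choose_spec.choose_spec.2 ψ
  · simpa only [tensorRight_comp_adjoint_rescale (hst _)] using hasSum_idTensor hρ

/-- The bound `|r(x, y)|² ≤ (∑ⱼ |fⱼ(x)|²) (∑ⱼ |gⱼ(y)|²)`. -/
lemma kernelBound_of_hasSum {lam : ℝ} {f g : ℕ → L2 n}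
    (hf : Summable fun j => ‖f j‖ ^ 2) (hg : Summable fun j => ‖g j‖ ^ 2)
    {r : Mom n → Mom n → ℂ}
    (hr : ∀ᵐ q ∂(volume : Measure (Mom n)).prod (paramMeasure n),
      HasSum (fun j => f j (initialPair lam q).2 * (starRingEnd ℂ) (g j (finalPair lam q).2))
        (r (initialPair lam q).2 (finalPair lam q).2)) :
    KernelBound r lam (fun x => ∑' j, ‖f j x‖ₑ ^ 2) (fun y => ∑' j, ‖g j y‖ₑ ^ 2) where
  measurable_left := measurable_tsum_enorm_sq f
  measurable_right := measurable_tsum_enorm_sq g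
  lintegral_left := lintegral_tsum_enorm_sq hf
  lintegral_right := lintegral_tsum_enorm_sq hg
  bound := by
    filter_upwards [hr] with q hq
    rw [← hq.tsum_eq]
    refine (pow_le_pow_left₀ zero_le enorm_tsum_le_tsum_enorm 2).trans ?_
    simp_rw [← lintegral_count]
    refine lintegral_sq_le_mul (measurable_of_countable _).aemeasurable
      (measurable_of_countable _).aemeasurable (Eventually.of_forall fun j => ?_)
    rw [enorm_mul, mul_pow, ← ofReal_norm ((starRingEnd ℂ) _), RCLike.norm_conj, ofReal_norm]

/-- The integrand of the sesquilinear form `⟨A U, V⟩`, in the heavy final momentum and the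
parameters. -/
def formIntegrand (a lam : ℝ) (U V : Mom n × Mom n → ℂ) (p : Mom n × Param n) : ℂ :=
  (starRingEnd ℂ) (scatteringCoeff n a lam ‖p.2.1‖) *
    ((starRingEnd ℂ) (U (finalPair lam p)) * V (initialPair lam p))

/-- The integrand of `⟨A U, V⟩` in the displacement momentum, the center-of-mass momentum and the
rotation. -/
def formIntegrandCM (a lam : ℝ) (U V : Mom n × Mom n → ℂ)
    (q : (Mom n × Mom n) × (Mom n →L[ℝ] Mom n)) : ℂ :=
  (starRingEnd ℂ) (scatteringCoeff n a lam ‖q.1.1‖) *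
    ((starRingEnd ℂ) (U (ofCM lam (rotateMap q))) * V (ofCM lam q.1))

lemma formIntegrandCM_collision (a : ℝ) {lam : ℝ} (hlam : 0 < lam) (U V : Mom n × Mom n → ℂ)
    (p : Mom n × Param n) :
    formIntegrandCM a lam U V (collision lam p) = formIntegrand a lam U V p := by
  simp only [formIntegrandCM, formIntegrand, ofCM_rotate_collision hlam]
  rw [ofCM_collision hlam]
  rfl

lemma measurable_conj_scatteringCoeff (a lam : ℝ) {α : Type*} [MeasurableSpace α] {h : α → Mom n}
    (hh : Measurable h) :
    Measurable fun x => (starRingEnd ℂ) (scatteringCoeff n a lam ‖h x‖) :=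
  Complex.continuous_conj.measurable.comp
    ((measurable_scatteringCoeff n a lam).comp hh.norm)

lemma integrable_formIntegrandCM [NeZero n] (a lam : ℝ) (U V : L2Pair n) :
    Integrable (formIntegrandCM a lam U V)
      ((volume : Measure (Mom n × Mom n)).prod (rotationMeasure n)) := by
  have hU := (Lp.memLp U).comp_measurePreserving
    ((measurePreserving_ofCM (n := n) lam).comp measurePreserving_rotateMap)
  have hV := (Lp.memLp V).comp_measurePreserving
    ((measurePreserving_ofCM (n := n) lam).comp
      (measurePreserving_fst (μ := (volume : Measure (Mom n × Mom n))) (ν := rotationMeasure n)))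
  refine Integrable.bdd_mul (c := 2) (hU.star.integrable_mul hV)
    (measurable_conj_scatteringCoeff a lam (by fun_prop)).aestronglyMeasurable
    (Eventually.of_forall fun q => ?_)
  rw [RCLike.norm_conj]
  exact norm_scatteringCoeff_le _ _ _ _

lemma compToCM_compOfCM (lam : ℝ) (V : L2Pair n) :
    Lp.compMeasurePreservingₗᵢ ℂ (toCM lam) (measurePreserving_toCM lam)
      (Lp.compMeasurePreservingₗᵢ ℂ (ofCM lam) (measurePreserving_ofCM lam) V) = V := by
  apply Lp.ext
  refine (Lp.coeFn_compMeasurePreserving _ (measurePreserving_toCM lam)).trans ?_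
  filter_upwards [(measurePreserving_toCM lam).quasiMeasurePreserving.ae
    (Lp.coeFn_compMeasurePreserving V (measurePreserving_ofCM lam))] with p hp
  refine hp.trans ?_
  rw [Function.comp_apply, ofCM_toCM]

lemma coeFn_radialOp [NeZero n] {m : ℝ → ℂ} (hm : Measurable m) {C : ℝ} (hC : ∀ k, ‖m k‖ ≤ C)
    (f : L2Pair n) :
    radialOp m hm C hC f =ᵐ[volume] fun p => m ‖p.1‖ * sphereMean f p :=
  (memLp_radial hm hC f).coeFn_toLp

lemma integral_rotateMap [NeZero n] {f : Mom n × Mom n → ℂ} (hf : StronglyMeasurable f)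
    (p : Mom n × Mom n) :
    sphereMean f p = ∫ σ, f (rotateMap (p, σ)) ∂rotationMeasure n := by
  have hf' : StronglyMeasurable fun x => f (x, p.2) := hf.comp_measurable measurable_prodMk_right
  have h := congrArg (fun ν : Measure (Mom n) => ∫ x, f (x, p.2) ∂ν) (map_rotation_apply p.1)
  rw [integral_map (by fun_prop) hf'.aestronglyMeasurable,
    integral_map (by fun_prop) hf'.aestronglyMeasurable] at h
  exact h.symm

lemma inner_scatteringA_eq_integral_CM [NeZero n] (a lam : ℝ) (U V : L2Pair n) :
    inner ℂ (scatteringA a lam U) V = ∫ q, formIntegrandCM a lam U V q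
      ∂(volume : Measure (Mom n × Mom n)).prod (rotationMeasure n) := by
  set U' := Lp.compMeasurePreservingₗᵢ ℂ (ofCM lam) (measurePreserving_ofCM lam) U with hU'
  set V' := Lp.compMeasurePreservingₗᵢ ℂ (ofCM lam) (measurePreserving_ofCM lam) V with hV'
  have hA : scatteringA a lam U = Lp.compMeasurePreservingₗᵢ ℂ (toCM lam)
      (measurePreserving_toCM lam) (radialOp (scatteringCoeff n a lam)
        (measurable_scatteringCoeff n a lam) 2 (norm_scatteringCoeff_le n a lam) U') := by
    simp [scatteringA, scatteringOp, hU']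
  rw [hA]
  conv_lhs => rw [← compToCM_compOfCM lam V]
  rw [LinearIsometry.inner_map_map, ← hV', L2.inner_def,
    integral_prod _ (integrable_formIntegrandCM a lam U V)]
  refine integral_congr_ae ?_
  have hUae : (U' : Mom n × Mom n → ℂ) =ᵐ[volume] fun p => U (ofCM lam p) :=
    Lp.coeFn_compMeasurePreserving U (measurePreserving_ofCM lam)
  have hVae : (V' : Mom n × Mom n → ℂ) =ᵐ[volume] fun p => V (ofCM lam p) :=
    Lp.coeFn_compMeasurePreserving V (measurePreserving_ofCM lam)
  filter_upwards [coeFn_radialOp (measurable_scatteringCoeff n a lam)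
    (norm_scatteringCoeff_le n a lam) U', hVae, sphereMean_congr hUae] with p h1 h2 h3
  have hUm : StronglyMeasurable fun p => U (ofCM lam p) :=
    (Lp.stronglyMeasurable U).comp_measurable (measurePreserving_ofCM lam).measurable
  rw [h1, h2, h3, RCLike.inner_apply, integral_rotateMap hUm, map_mul, ← integral_conj]
  simp only [formIntegrandCM]
  rw [integral_const_mul, integral_mul_const]
  ring

lemma integrable_formIntegrand [NeZero n] (a : ℝ) {lam : ℝ} (hlam : 0 < lam) (U V : L2Pair n) :
    Integrable (formIntegrand a lam U V)
      ((volume : Measure (Mom n)).prod (paramMeasure n)) := by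
  have h := (measurePreserving_collision hlam).integrable_comp_of_integrable
    ((integrable_formIntegrandCM a lam U V).smul_measure (jac_ne_top (n := n) lam))
  exact (funext (formIntegrandCM_collision a hlam U V) : _ = formIntegrand a lam U V) ▸ h

/-- The sesquilinear form of `A`, with the heavy final momentum as integration variable. -/
lemma inner_scatteringA [NeZero n] (a : ℝ) {lam : ℝ} (hlam : 0 < lam) (U V : L2Pair n) :
    inner ℂ (scatteringA a lam U) V = ((1 + lam : ℝ) : ℂ) ^ n *
      ∫ p, formIntegrand a lam U V p ∂(volume : Measure (Mom n)).prod (paramMeasure n) := by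
  have hi := (integrable_formIntegrandCM a lam U V).smul_measure (jac_ne_top (n := n) lam)
  have h := integral_map (measurable_collision (n := n) lam).aemeasurable
    (μ := (volume : Measure (Mom n)).prod (paramMeasure n)) (f := formIntegrandCM a lam U V)
    (by rw [map_collision hlam]; exact hi.1)
  rw [map_collision hlam, integral_smul_measure, ← inner_scatteringA_eq_integral_CM] at h
  simp_rw [formIntegrandCM_collision a hlam] at h
  have h1 : (1 + lam) ^ n ≠ 0 := by positivity
  rw [← h, jac, ENNReal.toReal_ofReal (by positivity), Complex.real_smul, ← mul_assoc]
  push_cast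
  rw [mul_inv_cancel₀ (by exact_mod_cast h1), one_mul]

lemma lintegral_formIntegrand_le [NeZero n] (a : ℝ) {lam : ℝ} (hlam : 0 < lam) (U V : L2Pair n) :
    ∫⁻ p, ‖formIntegrand a lam U V p‖ₑ ∂(volume : Measure (Mom n)).prod (paramMeasure n) ≤
      jac n lam * (‖U‖ₑ ^ 2 + ‖V‖ₑ ^ 2) := by
  have hU := (Lp.stronglyMeasurable U).measurable
  have hV := (Lp.stronglyMeasurable V).measurable
  have h1 := (measurePreserving_finalPair (n := n) hlam).lintegral_comp
    (f := fun x => ‖U x‖ₑ ^ 2) (by fun_prop)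
  have h2 := (measurePreserving_initialPair (n := n) hlam).lintegral_comp
    (f := fun x => ‖V x‖ₑ ^ 2) (by fun_prop)
  rw [lintegral_smul_measure, lintegral_enorm_sq, smul_eq_mul] at h1 h2
  have hm := measurable_finalPair (n := n) lam
  rw [mul_add, ← h1, ← h2, ← lintegral_add_left (by fun_prop)]
  refine lintegral_mono fun p => ?_
  simp only [← ofReal_norm, ← ENNReal.ofReal_pow (norm_nonneg _)]
  rw [← ENNReal.ofReal_add (by positivity) (by positivity)]
  refine ENNReal.ofReal_le_ofReal ?_
  rw [formIntegrand, norm_mul, norm_mul, RCLike.norm_conj, RCLike.norm_conj]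
  have h3 := norm_scatteringCoeff_le n a lam ‖p.2.1‖
  have h4 := mul_le_mul_of_nonneg_right h3
    (mul_nonneg (norm_nonneg (U (finalPair lam p))) (norm_nonneg (V (initialPair lam p))))
  -- `2 |U| |V| ≤ |U|² + |V|²`
  nlinarith [sq_nonneg (‖U (finalPair lam p)‖ - ‖V (initialPair lam p)‖)]

/-! ### Summation over the expansion and the partial trace -/

section FormSum

variable {a lam : ℝ} {f g : ℕ → L2 n} {r : Mom n → Mom n → ℂ}

lemma tsum_lintegral_formIntegrand_ne_top [NeZero n] (a : ℝ) (hlam : 0 < lam)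
    (hf : Summable fun j => ‖f j‖ ^ 2) (hg : Summable fun j => ‖g j‖ ^ 2) (w v : L2 n) :
    ∑' j, ∫⁻ p, ‖formIntegrand a lam (tensor w (g j)) (tensor v (f j)) p‖ₑ
      ∂(volume : Measure (Mom n)).prod (paramMeasure n) ≠ ∞ := by
  refine ne_top_of_le_ne_top ?_
    (ENNReal.tsum_le_tsum fun j =>
      lintegral_formIntegrand_le a hlam (tensor w (g j)) (tensor v (f j)))
  have h : ∀ w u : L2 n, ‖tensor w u‖ₑ ^ 2 = ‖w‖ₑ ^ 2 * ‖u‖ₑ ^ 2 := fun w u => by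
    rw [← ofReal_norm, norm_tensor, ENNReal.ofReal_mul (norm_nonneg _), ofReal_norm, ofReal_norm,
      mul_pow]
  simp_rw [h]
  rw [ENNReal.tsum_mul_left, ENNReal.tsum_add, ENNReal.tsum_mul_left, ENNReal.tsum_mul_left]
  refine ENNReal.mul_ne_top (jac_ne_top lam) (ENNReal.add_ne_top.2 ⟨?_, ?_⟩)
  · exact ENNReal.mul_ne_top (by simp) (tsum_enorm_sq_ne_top hg)
  · exact ENNReal.mul_ne_top (by simp) (tsum_enorm_sq_ne_top hf)

lemma hasSum_formIntegrand [NeZero n] (a : ℝ) (hlam : 0 < lam)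
    (hr : ∀ᵐ q ∂(volume : Measure (Mom n)).prod (paramMeasure n),
      HasSum (fun j => f j (initialPair lam q).2 * (starRingEnd ℂ) (g j (finalPair lam q).2))
        (r (initialPair lam q).2 (finalPair lam q).2)) (w v : L2 n) :
    ∀ᵐ p ∂(volume : Measure (Mom n)).prod (paramMeasure n),
      HasSum (fun j => formIntegrand a lam (tensor w (g j)) (tensor v (f j)) p)
        ((starRingEnd ℂ) (w p.1) * integrand r a lam p.2 v p.1) := by
  have h1 : ∀ᵐ p ∂(volume : Measure (Mom n)).prod (paramMeasure n), ∀ j,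
      tensor w (g j) (finalPair lam p) = w p.1 * g j (finalPair lam p).2 :=
    ae_all_iff.2 fun j => ae_finalPair hlam (coeFn_tensor w (g j))
  have h2 : ∀ᵐ p ∂(volume : Measure (Mom n)).prod (paramMeasure n), ∀ j,
      tensor v (f j) (initialPair lam p) =
        v (initialPair lam p).1 * f j (initialPair lam p).2 :=
    ae_all_iff.2 fun j => ae_initialPair hlam (coeFn_tensor v (f j))
  filter_upwards [h1, h2, hr] with p h1 h2 h3
  have h4 := h3.mul_left ((starRingEnd ℂ) (w p.1) *
    ((starRingEnd ℂ) (scatteringCoeff n a lam ‖p.2.1‖) * v (initialPair lam p).1))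
  have hterm : (fun j => formIntegrand a lam (tensor w (g j)) (tensor v (f j)) p) = fun j =>
      (starRingEnd ℂ) (w p.1) *
        ((starRingEnd ℂ) (scatteringCoeff n a lam ‖p.2.1‖) * v (initialPair lam p).1) *
          (f j (initialPair lam p).2 * (starRingEnd ℂ) (g j (finalPair lam p).2)) := by
    funext j
    rw [formIntegrand, h1, h2, map_mul]
    ring
  have htot : (starRingEnd ℂ) (w p.1) * integrand r a lam p.2 v p.1 =
      (starRingEnd ℂ) (w p.1) *
        ((starRingEnd ℂ) (scatteringCoeff n a lam ‖p.2.1‖) * v (initialPair lam p).1) *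
          r (initialPair lam p).2 (finalPair lam p).2 := by
    rw [integrand_apply]
    ring
  rw [hterm, htot]
  exact h4

/-- The expansion of the kernel turns the integral into the sum of the matrix elements of `A`. -/
lemma hasSum_inner_scatteringA [NeZero n] (a : ℝ) (hlam : 0 < lam)
    (hf : Summable fun j => ‖f j‖ ^ 2) (hg : Summable fun j => ‖g j‖ ^ 2)
    (hrc : Continuous (Function.uncurry r))
    (hr : ∀ᵐ q ∂(volume : Measure (Mom n)).prod (paramMeasure n),
      HasSum (fun j => f j (initialPair lam q).2 * (starRingEnd ℂ) (g j (finalPair lam q).2))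
        (r (initialPair lam q).2 (finalPair lam q).2)) (w v : L2 n) :
    HasSum (fun j => inner ℂ (scatteringA a lam (tensor w (g j))) (tensor v (f j)))
      (((1 + lam : ℝ) : ℂ) ^ n *
        inner ℂ w ((kernelBound_of_hasSum hf hg hr).partialOp hlam hrc a Set.univ v)) := by
  -- absolute convergence justifies the interchange of the integral with the sum over `j`
  have hfin := tsum_lintegral_formIntegrand_ne_top a hlam hf hg w v
  have hsum := hasSum_formIntegrand a hlam hr w v
  have hm : ∀ j, AEStronglyMeasurable (formIntegrand a lam (tensor w (g j)) (tensor v (f j)))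
      ((volume : Measure (Mom n)).prod (paramMeasure n)) := fun j =>
    (integrable_formIntegrand a hlam _ _).1
  have hint : Integrable (fun p : Mom n × Param n =>
      (starRingEnd ℂ) (w p.1) * integrand r a lam p.2 v p.1)
      ((volume : Measure (Mom n)).prod (paramMeasure n)) := by
    refine ⟨?_, ?_⟩
    · have hw := (Lp.stronglyMeasurable w).measurable
      exact ((Complex.continuous_conj.measurable.comp (hw.comp measurable_fst)).mul
        (measurable_integrand hrc a lam v)).aestronglyMeasurable
    · refine lt_of_le_of_lt (lintegral_mono_ae ?_)
        ((lintegral_tsum fun j => (hm j).enorm).trans_lt hfin.lt_top)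
      filter_upwards [hsum] with p hp
      rw [← hp.tsum_eq]
      exact enorm_tsum_le_tsum_enorm
  have hB : inner ℂ w ((kernelBound_of_hasSum hf hg hr).partialOp hlam hrc a Set.univ v) =
      ∑' j, ∫ p, formIntegrand a lam (tensor w (g j)) (tensor v (f j)) p
        ∂(volume : Measure (Mom n)).prod (paramMeasure n) := by
    rw [← integral_tsum hm hfin, integral_congr_ae (hsum.mono fun p hp => hp.tsum_eq),
      integral_prod _ hint, L2.inner_def]
    refine integral_congr_ae ?_
    filter_upwards [(kernelBound_of_hasSum hf hg hr).coeFn_partialOp hlam hrc a Set.univ v]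
      with P hP
    rw [RCLike.inner_apply, hP, partialIntegral, Measure.restrict_univ, integral_const_mul,
      mul_comm]
  have hsummable : Summable fun j =>
      inner ℂ (scatteringA a lam (tensor w (g j))) (tensor v (f j)) := by
    refine Summable.of_norm_bounded ((hg.add hf).mul_left
      (‖scatteringA (n := n) a lam‖ * ‖w‖ * ‖v‖)) fun j => ?_
    refine (norm_inner_le_norm _ _).trans ?_
    refine (mul_le_mul_of_nonneg_right ((scatteringA a lam).le_opNorm _) (norm_nonneg _)).trans ?_
    rw [norm_tensor, norm_tensor]
    have h1 : ‖g j‖ * ‖f j‖ ≤ ‖g j‖ ^ 2 + ‖f j‖ ^ 2 := by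
      nlinarith [sq_nonneg (‖g j‖ - ‖f j‖), sq_nonneg (‖g j‖), sq_nonneg (‖f j‖)]
    calc _ = (‖scatteringA (n := n) a lam‖ * ‖w‖ * ‖v‖) * (‖g j‖ * ‖f j‖) := by ring
      _ ≤ _ := by gcongr
  rw [hB, ← tsum_mul_left]
  simp_rw [← inner_scatteringA a hlam]
  exact hsummable.hasSum

end FormSum

section Trace

variable {H : Type*} [NormedAddCommGroup H] [InnerProductSpace ℂ H]

lemma hasSum_norm_inner_sq {ι : Type*} (e : HilbertBasis ι ℂ H) (x : H) :
    HasSum (fun i => ‖(inner ℂ (e i) x : ℂ)‖ ^ 2) (‖x‖ ^ 2) := by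
  have h2 := Complex.hasSum_re (e.hasSum_inner_mul_inner x x)
  have h3 : ∀ i, ((inner ℂ x (e i) : ℂ) * inner ℂ (e i) x).re = ‖(inner ℂ (e i) x : ℂ)‖ ^ 2 :=
    fun i => by
      rw [← inner_conj_symm x, ← Complex.normSq_eq_conj_mul_self, Complex.ofReal_re,
        Complex.normSq_eq_norm_sq]
  have h4 : (inner ℂ x x : ℂ).re = ‖x‖ ^ 2 := (norm_sq_eq_re_inner (𝕜 := ℂ) x).symm
  simpa only [h3, h4] using h2

/-- The trace of `∑ⱼ |fⱼ⟩⟨hⱼ|` in an orthonormal basis. The double series converges absolutely, by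
`|xy| ≤ |x|² + |y|²` and Parseval's identity. -/
lemma hasSum_tsum_inner_mul_inner {ι : Type*} (e : HilbertBasis ι ℂ H) {h f : ℕ → H}
    (hh : Summable fun j => ‖h j‖ ^ 2) (hf : Summable fun j => ‖f j‖ ^ 2) {c : ℂ}
    (hc : HasSum (fun j => inner ℂ (h j) (f j)) c) :
    HasSum (fun i => ∑' j, (inner ℂ (h j) (e i) : ℂ) * inner ℂ (e i) (f j)) c := by
  have hsq : ∀ {x : ℕ → H}, (Summable fun j => ‖x j‖ ^ 2) →
      Summable fun q : ℕ × ι => ‖(inner ℂ (e q.2) (x q.1) : ℂ)‖ ^ 2 := fun {x} hx => by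
    refine (summable_prod_of_nonneg fun q => by positivity).2
      ⟨fun j => (hasSum_norm_inner_sq e (x j)).summable, ?_⟩
    simpa only [(hasSum_norm_inner_sq e _).tsum_eq] using hx
  have hsum : Summable fun q : ℕ × ι =>
      (inner ℂ (h q.1) (e q.2) : ℂ) * inner ℂ (e q.2) (f q.1) := by
    refine Summable.of_norm_bounded ((hsq hh).add (hsq hf)) fun q => ?_
    rw [norm_mul, norm_inner_symm]
    nlinarith [sq_nonneg (‖(inner ℂ (e q.2) (h q.1) : ℂ)‖ - ‖(inner ℂ (e q.2) (f q.1) : ℂ)‖),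
      sq_nonneg ‖(inner ℂ (e q.2) (h q.1) : ℂ)‖, sq_nonneg ‖(inner ℂ (e q.2) (f q.1) : ℂ)‖]
  have htot := hsum.hasSum.prod_fiberwise fun j => e.hasSum_inner_mul_inner (h j) (f j)
  rw [← htot.unique hc]
  have hswap : Summable fun q : ι × ℕ =>
      (inner ℂ (h q.2) (e q.1) : ℂ) * inner ℂ (e q.1) (f q.2) := hsum.prod_symm
  rw [← (Equiv.prodComm ι ℕ).tsum_eq]
  exact hswap.hasSum.prod_fiberwise fun i => (hswap.prod_factor i).hasSum

lemma hasSum_inner_clm_apply {E : Type*} [NormedAddCommGroup E] [InnerProductSpace ℂ E]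
    {A : ℕ → E →L[ℂ] E} {T : E →L[ℂ] E} (hT : HasSum A T) (x y : E) :
    HasSum (fun j => (inner ℂ x (A j y) : ℂ)) (inner ℂ x (T y)) :=
  hT.mapL ((innerSL ℂ x).comp (ContinuousLinearMap.apply ℂ E y))

end Trace

lemma inner_tensor_tensorRight_comp (Y : L2Pair n →L[ℂ] L2Pair n) (f g w v u : L2 n) :
    inner ℂ (tensor w u) ((tensorRight f ∘L ContinuousLinearMap.adjoint (tensorRight g))
      (ContinuousLinearMap.adjoint Y (tensor v u))) =
    inner ℂ (ContinuousLinearMap.adjoint (tensorLeft v) (Y (tensor w g))) u * inner ℂ u f := by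
  have h1 : inner ℂ w (ContinuousLinearMap.adjoint (tensorRight g)
        (ContinuousLinearMap.adjoint Y (tensor v u))) = inner ℂ (Y (tensor w g)) (tensor v u) :=
    (ContinuousLinearMap.adjoint_inner_right (tensorRight g) _ _).trans
      (ContinuousLinearMap.adjoint_inner_right Y _ _)
  have h2 : inner ℂ (ContinuousLinearMap.adjoint (tensorLeft v) (Y (tensor w g))) u =
      inner ℂ (Y (tensor w g)) (tensor v u) :=
    ContinuousLinearMap.adjoint_inner_left (tensorLeft v) _ _
  exact (inner_tensor w u (ContinuousLinearMap.adjoint (tensorRight g)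
    (ContinuousLinearMap.adjoint Y (tensor v u))) f).trans
      (congrArg (· * inner ℂ u f) (h1.trans h2.symm))

/-- If `T = ∑ⱼ I ⊗ |fⱼ⟩⟨gⱼ|`, the partial trace of `T Y^*` has the matrix elements
`∑ⱼ ⟨Y (w ⊗ gⱼ), v ⊗ fⱼ⟩`. -/
lemma hasSum_trace {Y T : L2Pair n →L[ℂ] L2Pair n}
    {f g : ℕ → L2 n} (hf : Summable fun j => ‖f j‖ ^ 2) (hg : Summable fun j => ‖g j‖ ^ 2)
    (hT : HasSum (fun j => tensorRight (f j) ∘L ContinuousLinearMap.adjoint (tensorRight (g j))) T)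
    {w v : L2 n} {c : ℂ} (hc : HasSum (fun j => inner ℂ (Y (tensor w (g j))) (tensor v (f j))) c)
    {ι : Type*} (e : HilbertBasis ι ℂ (L2 n)) :
    HasSum (fun i => inner ℂ (tensor w (e i))
      ((T ∘L ContinuousLinearMap.adjoint Y) (tensor v (e i)))) c := by
  have hrow : ∀ i, inner ℂ (tensor w (e i))
      ((T ∘L ContinuousLinearMap.adjoint Y) (tensor v (e i))) =
      ∑' j, inner ℂ (ContinuousLinearMap.adjoint (tensorLeft v) (Y (tensor w (g j)))) (e i) *
        inner ℂ (e i) (f j) := fun i => by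
    have h := hasSum_inner_clm_apply hT (tensor w (e i))
      (ContinuousLinearMap.adjoint Y (tensor v (e i)))
    simp only [inner_tensor_tensorRight_comp] at h
    exact h.tsum_eq.symm
  have hle : ∀ j, ‖ContinuousLinearMap.adjoint (tensorLeft v) (Y (tensor w (g j)))‖ ≤
      ‖ContinuousLinearMap.adjoint (tensorLeft v)‖ * (‖Y‖ * (‖w‖ * ‖g j‖)) := fun j => by
    rw [← norm_tensor]
    exact (ContinuousLinearMap.le_opNorm _ _).trans
      (mul_le_mul_of_nonneg_left (Y.le_opNorm _) (norm_nonneg _))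
  simp only [hrow]
  refine hasSum_tsum_inner_mul_inner e ?_ hf ?_
  · refine Summable.of_nonneg_of_le (fun j => by positivity)
      (fun j => pow_le_pow_left₀ (norm_nonneg _) (hle j) 2) ?_
    simp only [mul_pow]
    exact ((hg.mul_left _).mul_left _).mul_left _
  · simp only [ContinuousLinearMap.adjoint_inner_left]
    exact hc

lemma isPartialTrace_of_hasSum {Y T : L2Pair n →L[ℂ] L2Pair n} {B : L2 n →L[ℂ] L2 n} {κ : ℂ}
    {f g : ℕ → L2 n} (hf : Summable fun j => ‖f j‖ ^ 2) (hg : Summable fun j => ‖g j‖ ^ 2)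
    (hT : HasSum (fun j => tensorRight (f j) ∘L ContinuousLinearMap.adjoint (tensorRight (g j))) T)
    (hB : ∀ w v, HasSum (fun j => inner ℂ (Y (tensor w (g j))) (tensor v (f j)))
      (κ * inner ℂ w (B v))) :
    IsPartialTrace (T ∘L ContinuousLinearMap.adjoint Y) (κ • B) := fun ι e w v => by
  have h := hasSum_trace hf hg hT (hB w v) e
  rwa [← inner_smul_right] at h

end PointScattering

end

open PointScattering
theorem mainTheorem3 (n : ℕ) [NeZero n] (hn : n ≤ 3) (a lam : ℝ) (ha : a ≠ 0) (hlam : 0 < lam)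
    (ρ : L2 n →L[ℂ] L2 n) (hρ : IsTraceClass ρ)
    (r : Mom n → Mom n → ℂ) (hr : Continuous (Function.uncurry r)) (hker : IsMomentumKernel ρ r) :
    ∃ B : L2 n →L[ℂ] L2 n,
      IsStrongIntegral ((volume : Measure (Mom n)).prod
        (rotationMeasure n)) (integrand r a lam) B ∧
      IsPartialTrace (idTensor hρ ∘L ContinuousLinearMap.adjoint (scatteringA a lam))
        (((1 + lam : ℝ) : ℂ) ^ n • B) := by
  obtain ⟨f, g, hf, hg, hexp, hI⟩ := hρ.exists_expansion
  obtain ⟨p, q, hp, hq, hpq⟩ := hasSum_kernel hf hg hexp hr hker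
  have hk : ∀ᵐ z ∂(volume : Measure (Mom n)).prod (paramMeasure n),
      HasSum (fun j => f j (initialPair lam z).2 * (starRingEnd ℂ) (g j (finalPair lam z).2))
        (r (initialPair lam z).2 (finalPair lam z).2) := by
    filter_upwards [ae_initialPair hlam (ae_snd hp), ae_finalPair hlam (ae_snd hq)] with z h1 h2
    exact hpq _ _ h1 h2
  exact ⟨(kernelBound_of_hasSum hf hg hk).partialOp hlam hr a Set.univ,
    (kernelBound_of_hasSum hf hg hk).isStrongIntegral hlam hr a,
    isPartialTrace_of_hasSum hf hg hI (hasSum_inner_scatteringA a hlam hf hg hr hk)⟩
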